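/- Let $H$ be a (real or complex) Hilbert space, $T>0$, and let $A$ be a self-adjoint, densely defined, in general unbounded operator in $H$ with $(Au,u)\ge\alpha\|u\|^2$ for all $u\in D(A)$, $\alpha>0$. Suppose $A=\sum_{j=1}^m A_j$ (so $D(A)=\bigcap_j D(A_j)$), where $A_j=A_j^*\ge\alpha_j I$ with $\alpha_j>0$. Let $M:H\to H$ satisfy $\|M(x)-M(y)\|\le a\|x-y\|$ for all $x,y\in H$, with a constant $a>0$, let $\varphi_0,\varphi_1\in H$ and $f:[0,T]\to H$, and let $u$ be a solution of $$u''(t)+Au(t)+M(u(t))=f(t),\quad t\in[0,T],\qquad u(0)=\varphi_0,\quad u'(0)=\varphi_1,$$ that is, $u:[0,T]\to H$ is twice continuously differentiable, $u(t)\in D(A)$ for all $t\in[0,T]$, the functions $Au(t)$ and $M(u(t))$ are continuous, and the equation holds on $[0,T]$ together with the initial conditions. Let $\eta_1,\dots,\eta_m$ be numbers with $0<\eta_j<1$ and $\sum_{j=1}^m\eta_j=1$. For an integer $n>1$ put $\tau=T/n$, $t_k=k\tau$, and define $v_0,\dots,v_n$ by $v_0=\varphi_0$, $v_1=\varphi_0+\tau\varphi_1$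 and, for $k=1,\dots,n-1$, $$v_{k+1}=\sum_{j=1}^m\eta_j\,y_{j,k+1},\qquad \eta_j\frac{y_{j,k+1}-2v_k+v_{k-1}}{\tau^2}+A_j\,y_{j,k+1}=\delta_{1,j}\bigl[f(t_k)-M(v_k)\bigr],\quad y_{j,k+1}\in D(A_j),\ j=1,\dots,m,$$ where $\delta_{1,j}$ is the Kronecker symbol. If $f$ and $A^{1/2}u$ satisfy a Hölder condition of order $\lambda$, $0<\lambda\le1$, on $[0,T]$, then there is a constant $c>0$, independent of $n$ (that is, of $\tau$) and of $k$, such that $$\|u(t_k)-v_k\|\le c\,\tau^{\lambda}\qquad\text{for all } n>1 \text{ and } k=0,1,\dots,n.$$ -/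

import Mathlib

open scoped NNReal

namespace AbstractHyperbolic

/-! ### Square roots of positive definite self-adjoint operators -/

section SquareRoot

variable {𝕜 H : Type*} [RCLike 𝕜] [NormedAddCommGroup H] [InnerProductSpace 𝕜 H]
  [CompleteSpace H]

/-- A (generally unbounded) operator `A` is positive definite: `α ‖x‖² ≤ (A x, x)` on `D(A)` for
some constant `α > 0`. -/
def IsPositiveDefinite (A : H →ₗ.[𝕜] H) : Prop :=
  ∃ α : ℝ, 0 < α ∧ ∀ x : A.domain, α * ‖(x : H)‖ ^ 2 ≤ RCLike.re (inner 𝕜 (A x) (x : H))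

/-- `R` is a nonnegative self-adjoint operator with `R² = A`, including equality of the domains
(`D(R²) = {x ∈ D(R) | R x ∈ D(R)}`). -/
structure IsPosSqrt (R A : H →ₗ.[𝕜] H) : Prop where
  isSelfAdjoint : IsSelfAdjoint R
  nonneg : ∀ x : R.domain, 0 ≤ RCLike.re (inner 𝕜 (R x) (x : H))
  sq : ∀ x y : H, (x, y) ∈ A.graph ↔ ∃ z, (x, z) ∈ R.graph ∧ (z, y) ∈ R.graph

theorem IsPosSqrt.domain_le {R A : H →ₗ.[𝕜] H} (h : IsPosSqrt R A) : A.domain ≤ R.domain := by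
  intro x hx
  obtain ⟨z, hz, -⟩ := (h.sq x (A ⟨x, hx⟩)).1 (LinearPMap.mem_graph A ⟨x, hx⟩)
  exact LinearPMap.mem_domain_of_mem_graph hz

theorem sum_catalan_le (N : ℕ) :
    ∑ n ∈ Finset.range N, (catalan n : ℝ) / 4 ^ n ≤ 2 := by
  induction N with
  | zero => simp
  | succ N ih =>
    rw [Finset.sum_range_succ']
    have h0 : 0 ≤ ∑ n ∈ Finset.range N, (catalan n : ℝ) / 4 ^ n :=
      Finset.sum_nonneg fun _ _ => by positivity
    have key : ∑ n ∈ Finset.range N, (catalan (n + 1) : ℝ) / 4 ^ (n + 1)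
        ≤ 1 / 4 * ((∑ n ∈ Finset.range N, (catalan n : ℝ) / 4 ^ n)
          * (∑ n ∈ Finset.range N, (catalan n : ℝ) / 4 ^ n)) := by
      have e : ∀ n, (catalan (n + 1) : ℝ) / 4 ^ (n + 1) =
          1 / 4 * ∑ p ∈ Finset.HasAntidiagonal.antidiagonal n,
            ((catalan p.1 : ℝ) / 4 ^ p.1) * ((catalan p.2 : ℝ) / 4 ^ p.2) := by
        intro n
        rw [catalan_succ']
        push_cast
        rw [Finset.sum_div, Finset.mul_sum]
        refine Finset.sum_congr rfl fun p hp => ?_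
        rw [← Finset.HasAntidiagonal.mem_antidiagonal.1 hp, pow_succ, pow_add]
        field_simp
      simp_rw [e]
      rw [← Finset.mul_sum, Finset.sum_mul_sum, ← Finset.sum_product', Finset.sum_sigma']
      refine mul_le_mul_of_nonneg_left ?_ (by norm_num)
      refine le_trans (le_of_eq ?_) (Finset.sum_le_sum_of_subset_of_nonneg
        (s := ((Finset.range N).sigma fun n => Finset.HasAntidiagonal.antidiagonal n).image fun q => q.2)
        ?_ ?_)
      · rw [Finset.sum_image]
        rintro ⟨a, p⟩ hp ⟨b, q⟩ hq h
        simp only [Finset.coe_sigma, Set.mem_sigma_iff, Finset.mem_coe,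
          Finset.HasAntidiagonal.mem_antidiagonal] at hp hq h
        subst h
        obtain rfl : a = b := by omega
        rfl
      · intro p hp
        simp only [Finset.mem_image, Finset.mem_sigma, Finset.mem_range,
          Finset.HasAntidiagonal.mem_antidiagonal] at hp
        obtain ⟨⟨n, q⟩, ⟨hn, hq⟩, rfl⟩ := hp
        simp only [Finset.mem_product, Finset.mem_range]
        simp only at hn hq
        omega
      · intro p _ _
        positivity
    simp only [catalan_zero, Nat.cast_one, pow_zero, div_one]
    nlinarith

theorem summable_catalan : Summable fun n : ℕ => (catalan n : ℝ) / 4 ^ n :=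
  summable_of_sum_range_le (fun _ => by positivity) sum_catalan_le

/-- A bounded operator `1 - X` with `X` self-adjoint, `‖X‖ ≤ 1`, has a nonnegative square root. -/
theorem exists_sqrt_one_sub (X : H →L[𝕜] H) (hX : IsSelfAdjoint X) (hX1 : ‖X‖ ≤ 1) :
    ∃ Y : H →L[𝕜] H, Y * Y = 1 - X ∧ IsSelfAdjoint Y ∧
      ∀ x, 0 ≤ RCLike.re (inner 𝕜 (Y x) x) := by
  let f : ℕ → (H →L[𝕜] H) := fun n => ((catalan n : 𝕜) / 4 ^ n) • X ^ n
  have hfn : ∀ n, ‖f n‖ ≤ (catalan n : ℝ) / 4 ^ n := by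
    intro n
    have h1 : ‖X ^ n‖ ≤ 1 := by
      induction n with
      | zero => exact ContinuousLinearMap.norm_id_le
      | succ n ih =>
        rw [pow_succ]
        exact (norm_mul_le _ _).trans (mul_le_one₀ ih (norm_nonneg _) hX1)
    have h2 : ‖((catalan n : 𝕜) / 4 ^ n)‖ = (catalan n : ℝ) / 4 ^ n := by
      simp
    calc ‖f n‖ = (catalan n : ℝ) / 4 ^ n * ‖X ^ n‖ := by rw [norm_smul, h2]
      _ ≤ (catalan n : ℝ) / 4 ^ n * 1 := by gcongr
      _ = _ := mul_one _
  have hfs : Summable fun n => ‖f n‖ :=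
    Summable.of_nonneg_of_le (fun _ => norm_nonneg _) hfn summable_catalan
  set K : H →L[𝕜] H := ∑' n, f n with hK
  have hK2 : ‖K‖ ≤ 2 := by
    refine (norm_tsum_le_tsum_norm hfs).trans ?_
    refine (hfs.tsum_le_tsum hfn summable_catalan).trans ?_
    exact Real.tsum_le_of_sum_range_le (fun _ => by positivity) sum_catalan_le
  have hKK : K = 1 + (1 / 4 : 𝕜) • (X * (K * K)) := by
    have h1 : K = f 0 + ∑' n, f (n + 1) := hfs.of_norm.tsum_eq_zero_add
    have h2 : K * K = ∑' n, ∑ p ∈ Finset.HasAntidiagonal.antidiagonal n, f p.1 * f p.2 :=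
      tsum_mul_tsum_eq_tsum_sum_antidiagonal_of_summable_norm hfs hfs
    have hs : Summable fun n => ∑ p ∈ Finset.HasAntidiagonal.antidiagonal n, f p.1 * f p.2 :=
      (summable_norm_sum_mul_antidiagonal_of_summable_norm hfs hfs).of_norm
    have h3 : ∀ n, f (n + 1) = (1 / 4 : 𝕜) • (X * ∑ p ∈ Finset.HasAntidiagonal.antidiagonal n, f p.1 * f p.2) := by
      intro n
      simp only [f]
      rw [catalan_succ', Finset.mul_sum, Finset.smul_sum]
      push_cast
      rw [Finset.sum_div, Finset.sum_smul]
      refine Finset.sum_congr rfl fun p hp => ?_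
      rw [← Finset.HasAntidiagonal.mem_antidiagonal.1 hp, smul_mul_smul_comm, mul_smul_comm, smul_smul, ← pow_add,
        ← pow_succ']
      congr 1
      rw [pow_succ, pow_add]
      field_simp
    calc K = f 0 + ∑' n, f (n + 1) := h1
      _ = 1 + (1 / 4 : 𝕜) • (X * (K * K)) := by
        congr 1
        · simp [f]
        · simp_rw [h3]
          rw [(hs.mul_left X).tsum_const_smul, hs.tsum_mul_left, h2]
  have hKsa : IsSelfAdjoint K := by
    have h1 : ∀ n, star (f n) = f n := by
      intro n
      have := (hX.pow n).star_eq
      simp only [f, star_smul, this]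
      congr 1
      simp
    rw [isSelfAdjoint_iff, hK, tsum_star]
    simp_rw [h1]
  have hcomm : Commute X K := by
    show X * K = K * X
    rw [hK, ← hfs.of_norm.tsum_mul_left, ← hfs.of_norm.tsum_mul_right]
    refine tsum_congr fun n => ?_
    simp only [f, mul_smul_comm, smul_mul_assoc]
    rw [← pow_succ, ← pow_succ']
  have hXKsa : IsSelfAdjoint (X * K) := by
    rw [isSelfAdjoint_iff, star_mul, hX.star_eq, hKsa.star_eq, hcomm.eq]
  refine ⟨1 - (1 / 2 : 𝕜) • (X * K), ?_, ?_, ?_⟩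
  · have e : X * K * (X * K) = X * (X * (K * K)) := by
      rw [mul_assoc, ← mul_assoc K X K, ← hcomm.eq, mul_assoc]
    have e2 : (1 / 4 : 𝕜) • (X * (X * (K * K))) = X * K - X := by
      have : X * K = X + (1 / 4 : 𝕜) • (X * (X * (K * K))) := by
        conv_lhs => rw [hKK]
        rw [mul_add, mul_one, mul_smul_comm]
      rw [this]; abel
    have e3 : (1 - (1 / 2 : 𝕜) • (X * K)) * (1 - (1 / 2 : 𝕜) • (X * K))
        = 1 - X * K + (1 / 4 : 𝕜) • (X * K * (X * K)) := by
      have e4 : (1 / 2 : 𝕜) • (X * K) + (1 / 2 : 𝕜) • (X * K) = X * K := by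
        rw [← add_smul]; norm_num
      have e5 : (1 / 2 : 𝕜) * (1 / 2) = 1 / 4 := by norm_num
      rw [sub_mul, mul_sub, one_mul, mul_sub, mul_one, smul_mul_smul_comm, e5, one_mul]
      have e6 : (1 : H →L[𝕜] H) - X * K
          = 1 - ((1 / 2 : 𝕜) • (X * K) + (1 / 2 : 𝕜) • (X * K)) := by rw [e4]
      rw [e6]
      abel
    rw [e3, e, e2]; abel
  · rw [isSelfAdjoint_iff, star_sub, star_one, star_smul, hXKsa.star_eq]
    congr 2
    simp
  · intro x
    have hb : ‖(X * K) x‖ ≤ 2 * ‖x‖ := by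
      refine ((X * K).le_opNorm x).trans ?_
      gcongr
      calc ‖X * K‖ ≤ ‖X‖ * ‖K‖ := norm_mul_le _ _
        _ ≤ 1 * 2 := by gcongr
        _ = 2 := by norm_num
    have h1 : RCLike.re (inner 𝕜 ((1 - (1 / 2 : 𝕜) • (X * K)) x) x)
        = ‖x‖ ^ 2 - 1 / 2 * RCLike.re (inner 𝕜 ((X * K) x) x) := by
      have : (1 / 2 : 𝕜) = ((1 / 2 : ℝ) : 𝕜) := by push_cast; rfl
      rw [this]
      simp only [sub_apply, one_apply_eq_self, smul_apply, inner_sub_left,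
        inner_smul_left, map_sub, inner_self_eq_norm_sq, RCLike.conj_ofReal, RCLike.re_ofReal_mul]
    rw [h1]
    have h2 := (RCLike.re_le_norm (inner 𝕜 ((X * K) x) x)).trans (norm_inner_le_norm _ _)
    nlinarith [norm_nonneg x]

/-- A positive definite self-adjoint operator has a bounded inverse on the whole space. -/
theorem exists_bounded_inverse {A : H →ₗ.[𝕜] H} (hA : IsSelfAdjoint A) {α : ℝ} (hα : 0 < α)
    (hpos : ∀ x : A.domain, α * ‖(x : H)‖ ^ 2 ≤ RCLike.re (inner 𝕜 (A x) (x : H))) :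
    ∃ G : H →L[𝕜] H, ∀ x y, (x, y) ∈ A.graph ↔ G y = x := by
  have hb : ∀ x : A.domain, α * ‖(x : H)‖ ≤ ‖A x‖ := by
    intro x
    have h1 := (hpos x).trans ((RCLike.re_le_norm _).trans (norm_inner_le_norm _ _))
    rcases (norm_nonneg (x : H)).eq_or_lt with h0 | h0
    · rw [← h0]; simp
    · refine le_of_mul_le_mul_right ?_ h0
      nlinarith
  have hinj : ∀ x x' y, (x, y) ∈ A.graph → (x', y) ∈ A.graph → x = x' := by
    intro x x' y h h'
    rw [LinearPMap.mem_graph_iff] at h h'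
    obtain ⟨a, ha, ha'⟩ := h
    obtain ⟨b, hb1, hb2⟩ := h'
    simp only at ha ha' hb1 hb2
    have h3 := hb (a - b)
    rw [LinearPMap.map_sub, ha', hb2, sub_self, norm_zero] at h3
    have h4 : ‖((a - b : A.domain) : H)‖ = 0 :=
      le_antisymm (by nlinarith) (norm_nonneg _)
    rw [norm_eq_zero, Submodule.coe_sub, sub_eq_zero] at h4
    rw [← ha, ← hb1, h4]
  have hclosed : IsClosed (LinearMap.range A.toFun : Set H) := by
    have hg : IsClosed (A.graph : Set (H × H)) := hA.isClosed
    have : CompleteSpace A.graph := hg.completeSpace_coe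
    let P : A.graph →L[𝕜] H := (ContinuousLinearMap.snd 𝕜 H H).comp A.graph.subtypeL
    have hP : AntilipschitzWith (Real.toNNReal (max 1 α⁻¹)) P := by
      refine AddMonoidHomClass.antilipschitz_of_bound P ?_
      rintro ⟨⟨x, y⟩, h⟩
      rw [LinearPMap.mem_graph_iff] at h
      obtain ⟨a, ha, ha'⟩ := h
      simp only at ha ha'
      subst ha ha'
      have hm : (0 : ℝ) ≤ max 1 α⁻¹ := le_trans zero_le_one (le_max_left _ _)
      rw [Real.coe_toNNReal _ hm]
      show max ‖(a : H)‖ ‖A a‖ ≤ max 1 α⁻¹ * ‖A a‖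
      refine max_le ?_ ?_
      · calc ‖(a : H)‖ = α⁻¹ * (α * ‖(a : H)‖) := by field_simp
          _ ≤ α⁻¹ * ‖A a‖ := by gcongr; exact hb a
          _ ≤ _ := by gcongr; exact le_max_right _ _
      · nlinarith [le_max_left 1 α⁻¹, norm_nonneg (A a)]
    have hr := hP.isClosed_range P.uniformContinuous
    convert hr using 1
    ext y
    simp only [SetLike.mem_coe, LinearMap.mem_range, Set.mem_range]
    constructor
    · rintro ⟨x, rfl⟩
      exact ⟨⟨_, LinearPMap.mem_graph A x⟩, rfl⟩
    · rintro ⟨⟨p, hp⟩, rfl⟩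
      rw [LinearPMap.mem_graph_iff] at hp
      obtain ⟨a, -, ha'⟩ := hp
      exact ⟨a, ha'⟩
  have hsurj : ∀ y, ∃ x, (x, y) ∈ A.graph := by
    have : CompleteSpace (LinearMap.range A.toFun) := hclosed.completeSpace_coe
    have htop : LinearMap.range A.toFun = ⊤ := by
      rw [← Submodule.orthogonal_eq_bot_iff, Submodule.eq_bot_iff]
      intro y hy
      have h1 : (y, (0 : H)) ∈ A.graph := by
        have h2 : A.adjoint.graph = A.graph := by rw [LinearPMap.isSelfAdjoint_def.1 hA]
        rw [← h2, LinearPMap.adjoint_graph_eq_graph_adjoint hA.dense_domain,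
          Submodule.mem_adjoint_iff]
        intro a b hab
        rw [LinearPMap.mem_graph_iff] at hab
        obtain ⟨c, -, hc⟩ := hab
        have := (Submodule.mem_orthogonal _ _).1 hy b ⟨c, hc⟩
        simp [this]
      exact hinj y 0 0 h1 A.graph.zero_mem
    intro y
    obtain ⟨x, hx⟩ : y ∈ LinearMap.range A.toFun := htop ▸ Submodule.mem_top
    exact ⟨x, (LinearPMap.mem_graph_iff A).2 ⟨x, rfl, hx⟩⟩
  choose g hg using hsurj
  let L : H →ₗ[𝕜] H :=
    { toFun := g
      map_add' := fun y y' => hinj _ _ _ (hg _) (A.graph.add_mem (hg y) (hg y'))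
      map_smul' := fun c y => hinj _ _ _ (hg _) (A.graph.smul_mem c (hg y)) }
  refine ⟨L.mkContinuous α⁻¹ ?_, ?_⟩
  · intro y
    obtain ⟨a, ha, ha'⟩ := (LinearPMap.mem_graph_iff A).1 (hg y)
    simp only at ha ha'
    have h1 := hb a
    rw [ha, ha'] at h1
    show ‖g y‖ ≤ α⁻¹ * ‖y‖
    calc ‖g y‖ = α⁻¹ * (α * ‖g y‖) := by field_simp
      _ ≤ α⁻¹ * ‖y‖ := by gcongr
  · intro x y
    refine ⟨fun h => hinj _ _ _ (hg y) h, ?_⟩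
    rintro rfl
    exact hg y

/-- Every positive definite self-adjoint operator has a nonnegative self-adjoint square root. -/
theorem exists_isPosSqrt {A : H →ₗ.[𝕜] H} (hA : IsSelfAdjoint A) (hpos : IsPositiveDefinite A) :
    ∃ R : H →ₗ.[𝕜] H, IsPosSqrt R A := by
  obtain ⟨α, hα, hpos⟩ := hpos
  obtain ⟨G, hG⟩ := exists_bounded_inverse hA hα hpos
  have hGd : ∀ y, ∃ a : A.domain, (a : H) = G y ∧ A a = y := fun y =>
    (LinearPMap.mem_graph_iff A).1 ((hG (G y) y).2 rfl)
  have hGsa : IsSelfAdjoint G := by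
    rw [ContinuousLinearMap.isSelfAdjoint_iff_isSymmetric]
    intro x y
    obtain ⟨a, ha, ha'⟩ := hGd x
    obtain ⟨b, hb, hb'⟩ := hGd y
    have h1 : A.IsFormalAdjoint A := by
      have := LinearPMap.adjoint_isFormalAdjoint hA.dense_domain
      rwa [LinearPMap.isSelfAdjoint_def.1 hA] at this
    have h2 := h1 a b
    rw [ha', hb', ha, hb] at h2
    exact h2.symm
  have hGb : ∀ y, α * ‖G y‖ ^ 2 ≤ RCLike.re (inner 𝕜 (G y) y) := by
    intro y
    obtain ⟨a, ha, ha'⟩ := hGd y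
    have := hpos a
    rwa [ha, ha', ← inner_re_symm] at this
  have hsa : ∀ r : ℝ, star (r : 𝕜) = r := fun r => by simp
  obtain ⟨Y, hYY, hYsa, hYpos⟩ := exists_sqrt_one_sub (1 - (α : 𝕜) • G)
    (by rw [isSelfAdjoint_iff, star_sub, star_one, star_smul, hGsa.star_eq, hsa])
    (by
      refine ContinuousLinearMap.opNorm_le_bound _ zero_le_one fun y => ?_
      rw [one_mul]
      refine le_of_sq_le_sq ?_ (norm_nonneg _)
      have h1 : ‖(1 - (α : 𝕜) • G) y‖ ^ 2
          = ‖y‖ ^ 2 - 2 * (α * RCLike.re (inner 𝕜 (G y) y)) + α ^ 2 * ‖G y‖ ^ 2 := by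
        simp only [sub_apply, one_apply_eq_self, smul_apply]
        rw [@norm_sub_sq 𝕜, inner_smul_right, RCLike.re_ofReal_mul, norm_smul, RCLike.norm_ofReal,
          mul_pow, sq_abs, ← inner_re_symm]
      rw [h1]
      have h2 := hGb y
      have h3 : 0 ≤ α * ‖G y‖ ^ 2 := by positivity
      nlinarith)
  rw [sub_sub_cancel] at hYY
  let c : ℝ := (Real.sqrt α)⁻¹
  have hc : c * c * α = 1 := by
    have := Real.mul_self_sqrt hα.le
    have h0 : Real.sqrt α ≠ 0 := (Real.sqrt_pos.2 hα).ne'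
    simp only [c]
    field_simp
    nlinarith
  let S : H →L[𝕜] H := (c : 𝕜) • Y
  have hSS : ∀ y, S (S y) = G y := by
    intro y
    have : S * S = G := by
      simp only [S]
      rw [smul_mul_smul_comm, hYY, smul_smul]
      have : (c : 𝕜) * c * α = 1 := by exact_mod_cast congrArg (fun r : ℝ => (r : 𝕜)) hc
      rw [this, one_smul]
    exact congrArg (fun T : H →L[𝕜] H => T y) this
  have hSsa : ∀ x y, inner 𝕜 (S x) y = inner 𝕜 x (S y) := by
    have : IsSelfAdjoint S := by
      simp only [S]
      rw [isSelfAdjoint_iff, star_smul, hYsa.star_eq, hsa]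
    exact (ContinuousLinearMap.isSelfAdjoint_iff_isSymmetric.1 this)
  have hSpos : ∀ x, 0 ≤ RCLike.re (inner 𝕜 (S x) x) := by
    intro x
    simp only [S, smul_apply, inner_smul_left, RCLike.conj_ofReal, RCLike.re_ofReal_mul]
    have : 0 ≤ c := by simp only [c]; positivity
    exact mul_nonneg this (hYpos x)
  have hSinj : ∀ x, S x = 0 → x = 0 := by
    intro x hx
    obtain ⟨a, ha, ha'⟩ := hGd x
    rw [← hSS, hx, map_zero] at ha
    rw [← ha', show a = 0 from Subtype.ext ha, LinearPMap.map_zero]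
  let Sp : H →ₗ.[𝕜] H := S.toPMap ⊤
  have hker : LinearMap.ker Sp.toFun = ⊥ := by
    rw [LinearMap.ker_eq_bot']
    intro x hx
    exact Subtype.ext (hSinj x hx)
  let R : H →ₗ.[𝕜] H := Sp.inverse
  have hR : ∀ x z, (x, z) ∈ R.graph ↔ S z = x := by
    intro x z
    simp only [R]
    rw [LinearPMap.inverse_graph hker, Submodule.mem_map]
    constructor
    · rintro ⟨⟨p, q⟩, hpq, h⟩
      obtain ⟨b, hb, hb'⟩ := (LinearPMap.mem_graph_iff _).1 hpq
      simp only [LinearEquiv.coe_coe, LinearEquiv.prodComm_apply, Prod.swap_prod_mk,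
        Prod.mk.injEq] at h
      obtain ⟨rfl, rfl⟩ := h
      simp only at hb hb'
      rw [← hb, ← hb']
      rfl
    · rintro rfl
      exact ⟨(z, S z), (LinearPMap.mem_graph_iff _).2 ⟨⟨z, trivial⟩, rfl, rfl⟩, rfl⟩
  have hdense : Dense (R.domain : Set H) := by
    refine hA.dense_domain.mono ?_
    intro x hx
    have h1 : G (A ⟨x, hx⟩) = x := (hG _ _).1 (LinearPMap.mem_graph A ⟨x, hx⟩)
    rw [← hSS] at h1
    exact LinearPMap.mem_domain_of_mem_graph ((hR x _).2 h1)
  refine ⟨R, ?_, ?_, ?_⟩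
  · rw [LinearPMap.isSelfAdjoint_def]
    refine LinearPMap.eq_of_eq_graph ?_
    rw [LinearPMap.adjoint_graph_eq_graph_adjoint hdense]
    ext ⟨p, q⟩
    rw [Submodule.mem_adjoint_iff, hR]
    constructor
    · intro h
      refine ext_inner_left 𝕜 fun b => ?_
      have := h (S b) b ((hR _ _).2 rfl)
      rw [sub_eq_zero] at this
      exact (hSsa b q).symm.trans this.symm
    · rintro rfl a b hab
      rw [← (hR _ _).1 hab, sub_eq_zero]
      exact (hSsa b q).symm
  · intro x
    have h1 := (hR _ _).1 (LinearPMap.mem_graph R x)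
    rw [← inner_re_symm]
    have h2 := hSpos (R x)
    rwa [h1] at h2
  · intro x y
    rw [hG]
    constructor
    · intro h
      exact ⟨S y, (hR _ _).2 ((hSS y).trans h), (hR _ _).2 rfl⟩
    · rintro ⟨z, h1, h2⟩
      rw [← (hR _ _).1 h1, ← (hR _ _).1 h2, hSS]

open scoped Classical in
/-- The square root `A^{1/2}` of a positive definite self-adjoint operator `A` (the zero operator
for an operator without a nonnegative self-adjoint square root). -/
noncomputable def sqrtOp (A : H →ₗ.[𝕜] H) : H →ₗ.[𝕜] H :=
  if h : ∃ R : H →ₗ.[𝕜] H, IsPosSqrt R A then h.choose else 0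

theorem isPosSqrt_sqrtOp {A : H →ₗ.[𝕜] H} (hA : IsSelfAdjoint A) (hpos : IsPositiveDefinite A) :
    IsPosSqrt (sqrtOp A) A := by
  have h := exists_isPosSqrt hA hpos
  rw [sqrtOp, dif_pos h]
  exact h.choose_spec

end SquareRoot

/-! ### The Cauchy problem and the parallel decomposition scheme -/

section Problem

variable {𝕜 H : Type*} [RCLike 𝕜] [NormedAddCommGroup H] [InnerProductSpace 𝕜 H]

open scoped Classical in
/-- The value `A x` for `x ∈ D(A)` (and `0` outside of `D(A)`). -/
noncomputable def opApply (A : H →ₗ.[𝕜] H) (x : H) : H :=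
  if h : x ∈ A.domain then A ⟨x, h⟩ else 0

variable [NormedSpace ℝ H]

/-- `u` is a solution on `[0, T]` of `u'' + A u + M(u) = f`, `u(0) = φ₀`, `u'(0) = φ₁`. The
derivatives are taken within `[0, T]`, that is, one-sided at the end points. -/
structure IsSolution (A : H →ₗ.[𝕜] H) (M : H → H) (T : ℝ) (f : ℝ → H) (φ₀ φ₁ : H)
    (u : ℝ → H) : Prop where
  contDiffOn : ContDiffOn ℝ 2 u (Set.Icc 0 T)
  mem_domain : ∀ t ∈ Set.Icc 0 T, u t ∈ A.domain
  continuousOn_op : ContinuousOn (fun t => opApply A (u t)) (Set.Icc 0 T)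
  continuousOn_nonlinear : ContinuousOn (fun t => M (u t)) (Set.Icc 0 T)
  equation : ∀ t ∈ Set.Icc 0 T,
    iteratedDerivWithin 2 u (Set.Icc 0 T) t + opApply A (u t) + M (u t) = f t
  initial_value : u 0 = φ₀
  initial_velocity : derivWithin u (Set.Icc 0 T) 0 = φ₁

/-- `v 0, …, v n` are produced, with the auxiliary vectors `y j k`, by the parallel decomposition
scheme with step `τ` and weights `η j` for the splitting into the operators `Aj j`. The index
`0 : Fin m` is the first one, the only one that receives the right-hand side. -/
structure IsSchemeSolution {m : ℕ} (Aj : Fin m → H →ₗ.[𝕜] H) (η : Fin m → ℝ) (M : H → H)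
    (f : ℝ → H) (φ₀ φ₁ : H) (τ : ℝ) (n : ℕ) (v : ℕ → H) (y : Fin m → ℕ → H) : Prop where
  initial_zero : v 0 = φ₀
  initial_one : v 1 = φ₀ + τ • φ₁
  mem_domain : ∀ k, 1 ≤ k → k + 1 ≤ n → ∀ j, y j (k + 1) ∈ (Aj j).domain
  step : ∀ k, 1 ≤ k → k + 1 ≤ n → ∀ j,
    (η j / τ ^ 2) • (y j (k + 1) - (2 : ℝ) • v k + v (k - 1)) + opApply (Aj j) (y j (k + 1)) =
      if (j : ℕ) = 0 then f (k * τ) - M (v k) else 0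
  average : ∀ k, 1 ≤ k → k + 1 ≤ n → v (k + 1) = ∑ j, η j • y j (k + 1)

end Problem

end AbstractHyperbolic

/-! With R_j = (1 + (τ²/η_j) A_j)⁻¹ and S = Σ η_j R_j, averaging the split equations gives v_{k+1} =
S(2v_k − v_{k−1}) + τ² R_1 g_k, where g_k = f(t_k) − M(v_k). Here S is symmetric with 0 ≤ S ≤ 1, so
the error z_k = u(t_k) − v_k satisfies z_{k+1} = S(2z_k − z_{k−1}) + ρ_k with z_0 = 0.

Stability is proved by duality. Pairing z_{k+1} with itself moves the recurrence onto a dual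
sequence w_i of the same form, whose energy (S d_i, d_i) + ((1−S) w_i, w_i), with d_i the backward
difference of w_i, does not increase. Hence ‖w_i‖ grows at most linearly in i, while the seminorm
q(w_i) = ((1−S) w_i, w_i)^{1/2} stays bounded (`IsFirm.norm_le_of_recurrence`). A residual bounded
by β q(w) + γ ‖w‖ then costs β + (k+1)γ.

The truncation error is therefore estimated only weakly, tested against w (`residual_le`,
`truncation_le`). The scalar mean value theorem replaces the second difference of (u, w) by τ²
(u''(ξ), w), and the equation is used at ξ. The leftover terms are τ²(1−R_j) A_j u(ξ) and τ²(1−R_1)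
F(t), F = f − M(u), of size τ² q(w); increments (1−S)(u(t) − u(ξ)) and (1−S)(u(t) − u(t−τ)), of size
τ · τ^λ q(w) because 1−S ≤ τ²A as forms and A^{1/2}u is Hölder; and τ²(F(ξ) − F(t)), of size τ^{2+λ}
‖w‖. Continuity of Au thus suffices, without a modulus. Summation over n = T/τ steps and a discrete
Gronwall inequality for M give τ^λ. -/

namespace AbstractHyperbolic

/-! ### Stability of the recurrence by a dual energy method -/

section Firm

variable {E : Type*} [NormedAddCommGroup E] [InnerProductSpace ℝ E]

/-- A symmetric, firmly nonexpansive operator, that is, `0 ≤ S ≤ 1`. -/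
structure IsFirm (S : E →ₗ[ℝ] E) : Prop where
  symm : ∀ x y, inner ℝ (S x) y = inner ℝ x (S y)
  firm : ∀ x, ‖S x‖ ^ 2 ≤ inner ℝ (S x) x

variable {S : E →ₗ[ℝ] E}

theorem IsFirm.norm_le (hS : IsFirm S) (x : E) : ‖S x‖ ≤ ‖x‖ := by
  have h1 := (hS.firm x).trans (real_inner_le_norm _ _)
  nlinarith [norm_nonneg (S x), norm_nonneg x]

theorem IsFirm.inner_nonneg (hS : IsFirm S) (x : E) : 0 ≤ inner ℝ (S x) x :=
  (sq_nonneg _).trans (hS.firm x)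

theorem IsFirm.inner_le (hS : IsFirm S) (x : E) : inner ℝ (S x) x ≤ ‖x‖ ^ 2 := by
  have h1 := real_inner_le_norm (S x) x
  nlinarith [norm_nonneg x, hS.norm_le x]

theorem IsFirm.defect_nonneg (hS : IsFirm S) (x : E) : 0 ≤ inner ℝ (x - S x) x := by
  rw [inner_sub_left, real_inner_self_eq_norm_sq]
  linarith [hS.inner_le x]

theorem IsFirm.defect_le (hS : IsFirm S) (x : E) : inner ℝ (x - S x) x ≤ ‖x‖ ^ 2 := by
  rw [inner_sub_left, real_inner_self_eq_norm_sq]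
  linarith [hS.inner_nonneg x]

theorem IsFirm.defect_symm (hS : IsFirm S) (x y : E) :
    inner ℝ (x - S x) y = inner ℝ (y - S y) x := by
  rw [inner_sub_left, inner_sub_left, hS.symm, real_inner_comm x y, real_inner_comm x (S y)]

/-- Cauchy–Schwarz for the form of `1 - S`. -/
theorem IsFirm.abs_defect_le (hS : IsFirm S) (x y : E) :
    |inner ℝ (x - S x) y| ≤ √(inner ℝ (x - S x) x) * √(inner ℝ (y - S y) y) := by
  -- The form at x + t y is a nonnegative quadratic in t, so its discriminant is at most 0; a
  -- vanishing leading coefficient is allowed.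
  have h := discrim_le_zero (a := inner ℝ (y - S y) y) (b := 2 * inner ℝ (x - S x) y)
    (c := inner ℝ (x - S x) x) fun t => by
      have h1 := hS.defect_nonneg (x + t • y)
      have h2 : inner ℝ (x + t • y - S (x + t • y)) (x + t • y) =
          inner ℝ (x - S x) x + t * inner ℝ (x - S x) y
          + t * inner ℝ (y - S y) x + t * t * inner ℝ (y - S y) y := by
        have : x + t • y - S (x + t • y) = (x - S x) + t • (y - S y) := by
          rw [map_add, map_smul, smul_sub]; abel
        rw [this]
        simp only [inner_add_left, inner_add_right, inner_smul_left, inner_smul_right,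
          RCLike.conj_to_real]
        ring
      rw [h2, ← hS.defect_symm x y] at h1
      linarith
  rw [discrim] at h
  rw [← Real.sqrt_mul (hS.defect_nonneg x)]
  apply Real.abs_le_sqrt
  nlinarith

/-- The iteration dual to the recurrence `z_{k+1} = S (2 z_k - z_{k-1})`, written for a vector and
its backward difference. -/
def dualStep (S : E →ₗ[ℝ] E) (p : E × E) : E × E := (S (p.1 + p.2), S (p.1 + p.2) - p.1)

/-- The energy of the dual iteration. -/
noncomputable def dualEnergy (S : E →ₗ[ℝ] E) (p : E × E) : ℝ :=
  inner ℝ (S p.2) p.2 + inner ℝ (p.1 - S p.1) p.1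

/-- An exact energy balance: with y = w + d, expanding ‖Sy − w‖² cancels the two ‖Sy‖² terms and
leaves (S(y−w), y−w) + ((1−S)w, w). -/
theorem IsFirm.norm_dualStep_snd_le (hS : IsFirm S) (p : E × E) :
    ‖(dualStep S p).2‖ ^ 2 + inner ℝ (S (p.1 + p.2) - S (S (p.1 + p.2))) (p.1 + p.2)
      = dualEnergy S p := by
  obtain ⟨w, d⟩ := p
  simp only [dualStep, dualEnergy]
  rw [← real_inner_self_eq_norm_sq]
  simp only [map_add, inner_sub_left, inner_sub_right, inner_add_left, inner_add_right]
  have e1 := hS.symm (S w) w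
  have e2 := hS.symm (S w) d
  have e3 := hS.symm (S d) w
  have e4 := hS.symm (S d) d
  have e5 := hS.symm w d
  have e6 := hS.symm d w
  have e7 := real_inner_comm (S w) w
  have e8 := real_inner_comm (S d) w
  have e9 := real_inner_comm (S w) d
  have e10 := real_inner_comm (S w) (S d)
  linarith

/-- Against the balance, S ≤ 1 handles the difference term, and (S(y − Sy), y − Sy) ≥ 0 lets Sy
replace y in the second slot of (S(1−S)y, y). -/
theorem IsFirm.dualEnergy_dualStep_le (hS : IsFirm S) (p : E × E) :
    dualEnergy S (dualStep S p) ≤ dualEnergy S p := by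
  rw [← hS.norm_dualStep_snd_le p]
  conv_lhs => rw [dualEnergy]
  refine add_le_add (hS.inner_le _) ?_
  simp only [dualStep]
  generalize p.1 + p.2 = y
  have h := hS.inner_nonneg (y - S y)
  simp only [map_sub, inner_sub_left, inner_sub_right] at h ⊢
  have e1 := hS.symm (S y) (S y)
  have e2 := hS.symm (S y) y
  have e3 := real_inner_comm (S (S y)) (S y)
  linarith

theorem IsFirm.dualEnergy_iterate_le (hS : IsFirm S) (w : E) (k : ℕ) :
    dualEnergy S ((dualStep S)^[k] (w, w)) ≤ ‖w‖ ^ 2 := by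
  induction k with
  | zero =>
    simp only [Function.iterate_zero, id, dualEnergy, inner_sub_left, real_inner_self_eq_norm_sq]
    linarith
  | succ k ih =>
    rw [Function.iterate_succ_apply']
    exact (hS.dualEnergy_dualStep_le _).trans ih

theorem IsFirm.norm_dual_snd_le (hS : IsFirm S) (w : E) (k : ℕ) :
    ‖((dualStep S)^[k] (w, w)).2‖ ≤ ‖w‖ := by
  cases k with
  | zero => simp
  | succ k =>
    rw [Function.iterate_succ_apply']
    refine le_of_sq_le_sq ?_ (norm_nonneg _)
    refine le_trans ?_ (hS.dualEnergy_iterate_le w k)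
    rw [← hS.norm_dualStep_snd_le]
    set y := ((dualStep S)^[k] (w, w)).1 + ((dualStep S)^[k] (w, w)).2
    -- The second term of the balance is (Sy, y) − ‖Sy‖² ≥ 0, hence it may be dropped.
    have h := hS.firm y
    have e := hS.symm (S y) y
    rw [real_inner_self_eq_norm_sq] at e
    rw [inner_sub_left]
    linarith

/-- The second components are backward differences of the first ones and are bounded by ‖w‖, so the
first ones telescope to linear growth. -/
theorem IsFirm.norm_dual_fst_le (hS : IsFirm S) (w : E) (k : ℕ) :
    ‖((dualStep S)^[k] (w, w)).1‖ ≤ (k + 1) * ‖w‖ := by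
  induction k with
  | zero => simp
  | succ k ih =>
    have h := hS.norm_dual_snd_le w (k + 1)
    rw [Function.iterate_succ_apply'] at h ⊢
    set p := (dualStep S)^[k] (w, w)
    have e : (dualStep S p).1 = (dualStep S p).2 + p.1 := by simp [dualStep]
    rw [e]
    refine (norm_add_le _ _).trans ?_
    push_cast
    linarith

/-- One of the two nonnegative terms of the energy. The absence of a factor k here is what saves a
power of τ in the final rate. -/
theorem IsFirm.defect_dual_le (hS : IsFirm S) (w : E) (k : ℕ) :
    √(inner ℝ (((dualStep S)^[k] (w, w)).1 - S ((dualStep S)^[k] (w, w)).1)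
      ((dualStep S)^[k] (w, w)).1) ≤ ‖w‖ := by
  rw [Real.sqrt_le_left (norm_nonneg _)]
  refine le_trans ?_ (hS.dualEnergy_iterate_le w k)
  rw [dualEnergy]
  linarith [hS.inner_nonneg ((dualStep S)^[k] (w, w)).2]

/-- Summation by parts along the recurrence: each dual step trades the pair (z_{k+1}, z_k) for (z_k,
z_{k−1}) and releases one residual, paired with the current dual vector. The component p.1 − p.2 is
the previous dual vector, which is zero for the start (w, w). -/
theorem IsFirm.inner_eq_dual (hS : IsFirm S) (z : ℕ → E) (k : ℕ) (p : E × E) :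
    inner ℝ (z (k + 1)) p.1 - inner ℝ (S (z k)) (p.1 - p.2) =
      inner ℝ (z 1) ((dualStep S)^[k] p).1
        - inner ℝ (S (z 0)) (((dualStep S)^[k] p).1 - ((dualStep S)^[k] p).2)
        + ∑ i ∈ Finset.range k, inner ℝ (z (i + 2) - S ((2 : ℝ) • z (i + 1) - z i))
            ((dualStep S)^[k - 1 - i] p).1 := by
  induction k generalizing p with
  | zero => simp
  | succ k ih =>
    rw [Finset.sum_range_succ, Function.iterate_succ_apply]
    have e : ∀ i ∈ Finset.range k, inner ℝ (z (i + 2) - S ((2 : ℝ) • z (i + 1) - z i))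
        ((dualStep S)^[k + 1 - 1 - i] p).1 =
        inner ℝ (z (i + 2) - S ((2 : ℝ) • z (i + 1) - z i))
          ((dualStep S)^[k - 1 - i] (dualStep S p)).1 := by
      intro i hi
      rw [← Function.iterate_succ_apply]
      congr 4
      have := Finset.mem_range.1 hi
      omega
    rw [Finset.sum_congr rfl e, ← add_assoc, ← ih (dualStep S p)]
    have e2 : k + 1 - 1 - k = 0 := by omega
    rw [e2, Function.iterate_zero, id]
    simp only [dualStep, map_sub, map_smul, map_add, inner_sub_left, inner_sub_right,
      inner_add_right, inner_smul_left, RCLike.conj_to_real]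
    have e3 := hS.symm (z (k + 1)) p.1
    have e4 := hS.symm (z (k + 1)) p.2
    linarith

/-- Stability of the recurrence `z_{k+1} = S (2 z_k - z_{k-1}) + ρ_k` with respect to
perturbations that are measured in the form of `1 - S` or in the norm. -/
theorem IsFirm.norm_le_of_recurrence (hS : IsFirm S) (z : ℕ → E) (hz : z 0 = 0) (k : ℕ)
    (β γ : ℕ → ℝ) (hβ : ∀ i < k, 0 ≤ β i) (hγ : ∀ i < k, 0 ≤ γ i)
    (hρ : ∀ i < k, ∀ w, |inner ℝ (z (i + 2) - S ((2 : ℝ) • z (i + 1) - z i)) w| ≤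
      β i * √(inner ℝ (w - S w) w) + γ i * ‖w‖) :
    -- The test vector is z_{k+1} itself; one factor ‖z_{k+1}‖ is cancelled at the end.
    ‖z (k + 1)‖ ≤ (k + 1) * ‖z 1‖ + ∑ i ∈ Finset.range k, (β i + (k + 1) * γ i) := by
  set w := z (k + 1) with hw
  have h := hS.inner_eq_dual z k (w, w)
  simp only [sub_self, inner_zero_right, sub_zero, hz, map_zero, inner_zero_left] at h
  rw [← hw, real_inner_self_eq_norm_sq] at h
  have h1 : inner ℝ (z 1) ((dualStep S)^[k] (w, w)).1 ≤ (k + 1) * ‖z 1‖ * ‖w‖ := by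
    refine (real_inner_le_norm _ _).trans ?_
    have := mul_le_mul_of_nonneg_left (hS.norm_dual_fst_le w k) (norm_nonneg (z 1))
    linarith
  have h2 : ∑ i ∈ Finset.range k, inner ℝ (z (i + 2) - S ((2 : ℝ) • z (i + 1) - z i))
            ((dualStep S)^[k - 1 - i] (w, w)).1 ≤
      (∑ i ∈ Finset.range k, (β i + (k + 1) * γ i)) * ‖w‖ := by
    rw [Finset.sum_mul]
    refine Finset.sum_le_sum fun i hi => ?_
    have hi := Finset.mem_range.1 hi
    refine (le_abs_self _).trans ((hρ i hi _).trans ?_)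
    have h3 := mul_le_mul_of_nonneg_left (hS.defect_dual_le w (k - 1 - i)) (hβ i hi)
    have h4 := mul_le_mul_of_nonneg_left (hS.norm_dual_fst_le w (k - 1 - i)) (hγ i hi)
    have h5 : ((k - 1 - i : ℕ) : ℝ) + 1 ≤ k + 1 := by
      have : k - 1 - i ≤ k := by omega
      have : ((k - 1 - i : ℕ) : ℝ) ≤ k := by exact_mod_cast this
      linarith
    have h6 := mul_le_mul_of_nonneg_left
      (mul_le_mul_of_nonneg_right h5 (norm_nonneg w)) (hγ i hi)
    linarith
  rcases (norm_nonneg w).eq_or_lt with h0 | h0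
  · rw [← h0]
    have : 0 ≤ ∑ i ∈ Finset.range k, (β i + (k + 1) * γ i) :=
      Finset.sum_nonneg fun i hi => by
        have hi := Finset.mem_range.1 hi
        have := hβ i hi
        have := hγ i hi
        positivity
    positivity
  · refine le_of_mul_le_mul_right ?_ h0
    nlinarith

/-- Firmness survives averaging because the squared norm is convex. -/
theorem IsFirm.convexSum {ι : Type*} [Fintype ι] {R : ι → E →ₗ[ℝ] E} (hR : ∀ j, IsFirm (R j))
    {η : ι → ℝ} (hη : ∀ j, 0 ≤ η j) (hsum : ∑ j, η j = 1) : IsFirm (∑ j, η j • R j) where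
  symm x y := by
    simp only [LinearMap.sum_apply, LinearMap.smul_apply, sum_inner, inner_sum, inner_smul_left,
      inner_smul_right, RCLike.conj_to_real, (hR _).symm]
  firm x := by
    have h := (convexOn_pow (𝕜 := ℝ) 2).map_sum_le (t := Finset.univ) (w := η)
      (p := fun j => ‖R j x‖) (fun j _ => hη j) hsum (fun j _ => norm_nonneg _)
    simp only [smul_eq_mul] at h
    simp only [LinearMap.sum_apply, LinearMap.smul_apply, sum_inner, inner_smul_left,
      RCLike.conj_to_real]
    calc ‖∑ j, η j • R j x‖ ^ 2 ≤ (∑ j, η j * ‖R j x‖) ^ 2 := by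
          refine pow_le_pow_left₀ (norm_nonneg _) ((norm_sum_le _ _).trans_eq ?_) 2
          refine Finset.sum_congr rfl fun j _ => ?_
          rw [norm_smul, Real.norm_of_nonneg (hη j)]
      _ ≤ ∑ j, η j * ‖R j x‖ ^ 2 := h
      _ ≤ _ := Finset.sum_le_sum fun j _ => mul_le_mul_of_nonneg_left ((hR j).firm x) (hη j)

end Firm

/-! ### Mean value, Taylor and Gronwall estimates -/

section Calculus

theorem exists_second_difference_eq {φ φ' φ'' : ℝ → ℝ} {t τ : ℝ} (hτ : 0 < τ)
    (hc : ContinuousOn φ (Set.Icc (t - τ) (t + τ)))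
    (h1 : ∀ x ∈ Set.Ioo (t - τ) (t + τ), HasDerivAt φ (φ' x) x)
    (h2 : ∀ x ∈ Set.Ioo (t - τ) (t + τ), HasDerivAt φ' (φ'' x) x) :
    ∃ ξ ∈ Set.Ioo (t - τ) (t + τ), φ (t + τ) - 2 * φ t + φ (t - τ) = τ ^ 2 * φ'' ξ := by
  -- Cauchy's mean value theorem compares φ(t+s) + φ(t−s) with s² on [0, τ]; Lagrange's theorem for
  -- φ' on [t−c, t+c] then produces φ''(ξ). Derivatives are needed only in the open interval.
  obtain ⟨c, hc, hc2⟩ := exists_ratio_hasDerivAt_eq_ratio_slope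
    (fun s => φ (t + s) + φ (t - s)) (fun s => φ' (t + s) - φ' (t - s)) hτ
    (by
      refine ContinuousOn.add (hc.comp (by fun_prop) fun s hs => ?_)
        (hc.comp (by fun_prop) fun s hs => ?_) <;>
      · simp only [Set.mem_Icc] at hs ⊢
        constructor <;> linarith)
    (by
      intro s hs
      simp only [Set.mem_Ioo] at hs
      have e1 := (h1 (t + s) ⟨by linarith, by linarith⟩).comp_const_add t s
      have e2 := (h1 (t - s) ⟨by linarith, by linarith⟩).comp_const_sub t s
      exact e1.add e2)
    (fun s => s ^ 2) (fun s => 2 * s) (by fun_prop)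
    (by intro s _; simpa using hasDerivAt_pow 2 s)
  simp only [Set.mem_Ioo] at hc
  obtain ⟨ξ, hξ, hξ2⟩ := exists_hasDerivAt_eq_slope φ' φ'' (a := t - c) (b := t + c) (by linarith)
    (fun s hs => (h2 s ⟨by linarith [hs.1], by linarith [hs.2]⟩).continuousAt.continuousWithinAt)
    (fun s hs => h2 s ⟨by linarith [hs.1], by linarith [hs.2]⟩)
  refine ⟨ξ, ⟨by linarith [hξ.1], by linarith [hξ.2]⟩, ?_⟩
  have hc0 : t + c - (t - c) ≠ 0 := by linarith [hc.1]
  rw [eq_div_iff hc0] at hξ2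
  have hcne : c ≠ 0 := hc.1.ne'
  simp only [add_zero, sub_zero] at hc2
  refine mul_right_cancel₀ (b := 2 * c) (by simpa using hcne) ?_
  linear_combination τ ^ 2 * (-hξ2) - hc2

variable {E : Type*} [NormedAddCommGroup E] [NormedSpace ℝ E]

theorem hasDerivAt_of_contDiffOn_two {u : ℝ → E} {T : ℝ} (hu : ContDiffOn ℝ 2 u (Set.Icc 0 T))
    {t : ℝ} (ht : t ∈ Set.Ioo 0 T) :
    HasDerivAt u (derivWithin u (Set.Icc 0 T) t) t ∧
      HasDerivAt (derivWithin u (Set.Icc 0 T)) (iteratedDerivWithin 2 u (Set.Icc 0 T) t) t := by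
  have hT : (0 : ℝ) < T := ht.1.trans ht.2
  have hn : Set.Icc 0 T ∈ nhds t := Icc_mem_nhds ht.1 ht.2
  have hm : t ∈ Set.Icc 0 T := ⟨ht.1.le, ht.2.le⟩
  have hd : UniqueDiffOn ℝ (Set.Icc (0 : ℝ) T) := uniqueDiffOn_Icc hT
  refine ⟨((hu.differentiableOn (by norm_num)) t hm).hasDerivWithinAt.hasDerivAt hn, ?_⟩
  have h1 : ContDiffOn ℝ 1 (derivWithin u (Set.Icc 0 T)) (Set.Icc 0 T) :=
    hu.derivWithin hd (by norm_num)
  have h2 : iteratedDerivWithin 2 u (Set.Icc 0 T) t =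
      derivWithin (derivWithin u (Set.Icc 0 T)) (Set.Icc 0 T) t := by
    rw [iteratedDerivWithin_succ]
    refine derivWithin_congr (fun x hx => ?_) ?_
    · exact congrFun iteratedDerivWithin_one x
    · exact congrFun iteratedDerivWithin_one t
  rw [h2]
  exact ((h1.differentiableOn (by norm_num)) t hm).hasDerivWithinAt.hasDerivAt hn

/-- First-order Taylor bound at 0: it controls the error of the starting value v_1 = φ₀ + τφ₁. -/
theorem exists_first_step_bound {u : ℝ → E} {T : ℝ} (hT : 0 < T)
    (hu : ContDiffOn ℝ 2 u (Set.Icc 0 T)) :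
    ∃ C, 0 ≤ C ∧ ∀ t ∈ Set.Icc 0 T,
      ‖u t - (u 0 + t • derivWithin u (Set.Icc 0 T) 0)‖ ≤ C * t ^ 2 := by
  have hd : UniqueDiffOn ℝ (Set.Icc (0 : ℝ) T) := uniqueDiffOn_Icc hT
  have h2 : ContinuousOn (iteratedDerivWithin 2 u (Set.Icc 0 T)) (Set.Icc 0 T) :=
    hu.continuousOn_iteratedDerivWithin le_rfl hd
  obtain ⟨C, hC⟩ := isCompact_Icc.exists_bound_of_continuousOn h2
  have h0 : (0 : ℝ) ∈ Set.Icc 0 T := ⟨le_rfl, hT.le⟩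
  refine ⟨C, (norm_nonneg _).trans (hC 0 h0), fun t ht => ?_⟩
  have h := taylor_mean_remainder_bound (n := 1) hT.le (f := u) (C := C) (by exact_mod_cast hu)
    ht hC
  rw [taylorWithinEval_succ, taylor_within_zero_eval] at h
  simpa [iteratedDerivWithin_one] using h

theorem exists_lipschitz_of_contDiffOn {u : ℝ → E} {T : ℝ} (hT : 0 < T)
    (hu : ContDiffOn ℝ 2 u (Set.Icc 0 T)) :
    ∃ C, 0 ≤ C ∧ ∀ t ∈ Set.Icc 0 T, ∀ s ∈ Set.Icc 0 T, ‖u t - u s‖ ≤ C * |t - s| := by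
  have hd : UniqueDiffOn ℝ (Set.Icc (0 : ℝ) T) := uniqueDiffOn_Icc hT
  obtain ⟨C, hC⟩ := isCompact_Icc.exists_bound_of_continuousOn
    (hu.continuousOn_derivWithin hd (by norm_num))
  have h0 : (0 : ℝ) ∈ Set.Icc 0 T := ⟨le_rfl, hT.le⟩
  refine ⟨C, (norm_nonneg _).trans (hC 0 h0), fun t ht s hs => ?_⟩
  exact (convex_Icc (0 : ℝ) T).norm_image_sub_le_of_norm_derivWithin_le
    (hu.differentiableOn (by norm_num)) hC hs ht

theorem discrete_gronwall {e : ℕ → ℝ} {C q : ℝ} {n : ℕ} (hq : 0 ≤ q)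
    (h : ∀ k ≤ n, e k ≤ C + q * ∑ i ∈ Finset.range k, e i) {k : ℕ} (hk : k ≤ n) :
    e k ≤ C * (1 + q) ^ k := by
  refine (h k hk).trans ?_
  -- After the first reduction the quantity under induction is the majorant C + q Σ e_i, so no sign
  -- of e is required.
  induction k with
  | zero => simp
  | succ k ih =>
    have h1 := ih (by omega)
    have h2 := mul_le_mul_of_nonneg_left ((h k (by omega)).trans h1) hq
    rw [Finset.sum_range_succ, pow_succ]
    linarith

end Calculus

/-! ### Weak estimate of the residual in the form of 1 − S -/

section Residual

variable {E : Type*} [NormedAddCommGroup E] [InnerProductSpace ℝ E]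

/-- If `R` acts as the resolvent `(1 + c A)⁻¹` and `b = A x`, then the form of `1 - R` is bounded by
the form of `c A`. -/
theorem IsFirm.defect_le_of_resolvent {R : E →ₗ[ℝ] E} (hR : IsFirm R) {c : ℝ} {x b : E}
    (h : c • R b = x - R x) : inner ℝ (x - R x) x ≤ c * inner ℝ b x := by
  have hx : x = R x + c • R b := by rw [h]; abel
  -- Moving R to the left turns cRb into x − Rx. With x = Rx + cRb, the gap between the two forms
  -- becomes ‖x − Rx‖² + c²(b − Rb, Rb), both nonnegative.
  have h2 : inner ℝ (c • b - c • R b) (R x) = ‖x - R x‖ ^ 2 := by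
    rw [← hR.symm, map_sub, map_smul, map_smul, h, ← map_smul, h, ← real_inner_self_eq_norm_sq]
    simp only [inner_sub_left, inner_sub_right, map_sub]
    have e1 := hR.symm (R x) x
    have e2 := hR.symm x x
    have e3 := real_inner_comm (R x) x
    linarith
  have h3 : 0 ≤ inner ℝ (b - R b) (R b) := by
    have := hR.firm b
    rw [inner_sub_left, real_inner_self_eq_norm_sq, real_inner_comm]
    linarith
  have h4 : c * inner ℝ b x - inner ℝ (x - R x) x = inner ℝ (c • b - c • R b) x := by
    rw [← h, ← real_inner_smul_left, ← inner_sub_left]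
  have h5 : inner ℝ (c • b - c • R b) x = inner ℝ (c • b - c • R b) (R x)
      + c * c * inner ℝ (b - R b) (R b) := by
    conv_lhs => rw [hx]
    rw [inner_add_right, ← smul_sub, inner_smul_left, inner_smul_left, inner_smul_right]
    simp only [RCLike.conj_to_real]
    ring
  have h6 := mul_nonneg (mul_self_nonneg c) h3
  nlinarith [sq_nonneg ‖x - R x‖]

variable {ι : Type*} [Fintype ι] {R : ι → E →ₗ[ℝ] E} {η : ι → ℝ}

theorem defect_convexSum (hsum : ∑ j, η j = 1) (x : E) :
    x - (∑ j, η j • R j) x = ∑ j, η j • (x - R j x) := by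
  simp only [smul_sub, Finset.sum_sub_distrib, ← Finset.sum_smul, hsum, one_smul,
    LinearMap.sum_apply, LinearMap.smul_apply]

/-- The form of 1 − S is Σ η_i times the nonnegative forms of 1 − R_i; only the j-th summand is
kept. -/
theorem sqrt_defect_le_convexSum (hR : ∀ j, IsFirm (R j)) (hη : ∀ j, 0 < η j)
    (hsum : ∑ j, η j = 1) (j : ι) (w : E) :
    √(inner ℝ (w - R j w) w) ≤ (√(η j))⁻¹ * √(inner ℝ (w - (∑ j, η j • R j) w) w) := by
  rw [← Real.sqrt_inv, ← Real.sqrt_mul (inv_nonneg.2 (hη j).le)]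
  refine Real.sqrt_le_sqrt ?_
  rw [le_inv_mul_iff₀ (hη j), defect_convexSum hsum, sum_inner]
  simp only [inner_smul_left, RCLike.conj_to_real]
  exact Finset.single_le_sum (f := fun j => η j * inner ℝ (w - R j w) w)
    (fun i _ => mul_nonneg (hη i).le ((hR i).defect_nonneg w)) (Finset.mem_univ j)

theorem abs_defect_le_convexSum (hR : ∀ j, IsFirm (R j)) (hη : ∀ j, 0 < η j)
    (hsum : ∑ j, η j = 1) (j : ι) (x w : E) :
    |inner ℝ (x - R j x) w| ≤
      (√(η j))⁻¹ * ‖x‖ * √(inner ℝ (w - (∑ j, η j • R j) w) w) := by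
  have h1 : √(inner ℝ (x - R j x) x) ≤ ‖x‖ := by
    rw [Real.sqrt_le_left (norm_nonneg _)]
    exact (hR j).defect_le x
  refine ((hR j).abs_defect_le x w).trans ?_
  refine (mul_le_mul h1 (sqrt_defect_le_convexSum hR hη hsum j w) (Real.sqrt_nonneg _)
    (norm_nonneg _)).trans_eq ?_
  ring

/-- If the `R j` act as the resolvents `(1 + (τ² / η j) A j)⁻¹` and `b j = A j x`, then the form of
`1 - ∑ η j R j` is bounded by the form of `τ² ∑ A j`. -/
theorem defect_convexSum_le_of_resolvent (hR : ∀ j, IsFirm (R j)) (hη : ∀ j, 0 < η j)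
    (hsum : ∑ j, η j = 1) {τ : ℝ} {x : E} {b : ι → E}
    (h : ∀ j, (τ ^ 2 / η j) • R j (b j) = x - R j x) :
    inner ℝ (x - (∑ j, η j • R j) x) x ≤ τ ^ 2 * inner ℝ (∑ j, b j) x := by
  rw [defect_convexSum hsum, sum_inner, sum_inner, Finset.mul_sum]
  refine Finset.sum_le_sum fun j _ => ?_
  have h1 := mul_le_mul_of_nonneg_left ((hR j).defect_le_of_resolvent (h j)) (hη j).le
  rw [inner_smul_left, RCLike.conj_to_real]
  refine h1.trans_eq ?_
  have := (hη j).ne'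
  field_simp

/-- The algebraic core of consistency: x₀, xm, xp are u at t, t−τ, t+τ, and xi, Fi, b are taken at
the mean value point. Everything except Fi − F₀ carries a factor 1 − R_j or 1 − S and is measured by
the form of 1 − S. -/
theorem residual_le (hR : ∀ j, IsFirm (R j)) (hη : ∀ j, 0 < η j) (hsum : ∑ j, η j = 1)
    (j₀ : ι) {τ γ κ CF Ca : ℝ} {x₀ xm xp xi F₀ Fi w : E} {b : ι → E}
    (hsecond : inner ℝ (xp - (2 : ℝ) • x₀ + xm) w = τ ^ 2 * inner ℝ (Fi - ∑ j, b j) w)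
    (hb : ∀ j, (τ ^ 2 / η j) • R j (b j) = xi - R j xi)
    (hF : ‖Fi - F₀‖ ≤ γ) (hF₀ : ‖F₀‖ ≤ CF) (hCa : ∀ j, ‖b j‖ ≤ Ca)
    (h1 : √(inner ℝ ((x₀ - xi) - (∑ j, η j • R j) (x₀ - xi)) (x₀ - xi)) ≤ κ)
    (h2 : √(inner ℝ ((x₀ - xm) - (∑ j, η j • R j) (x₀ - xm)) (x₀ - xm)) ≤ κ) :
    |inner ℝ (xp - (∑ j, η j • R j) ((2 : ℝ) • x₀ - xm) - τ ^ 2 • R j₀ F₀) w| ≤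
      (τ ^ 2 * ((√(η j₀))⁻¹ * CF + ∑ j, (√(η j))⁻¹ * Ca) + 2 * κ)
        * √(inner ℝ (w - (∑ j, η j • R j) w) w) + τ ^ 2 * γ * ‖w‖ := by
  set S := ∑ j, η j • R j with hS
  have hSf : IsFirm S := IsFirm.convexSum hR (fun j => (hη j).le) hsum
  set q := √(inner ℝ (w - S w) w) with hq
  have hq0 : 0 ≤ q := Real.sqrt_nonneg _
  have hDi : xi - S xi = τ ^ 2 • ∑ j, R j (b j) := by
    rw [hS, defect_convexSum hsum, Finset.smul_sum]
    refine Finset.sum_congr rfl fun j _ => ?_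
    rw [← hb, smul_smul]
    congr 1
    have := (hη j).ne'
    field_simp
  have key : inner ℝ (xp - S ((2 : ℝ) • x₀ - xm) - τ ^ 2 • R j₀ F₀) w =
      τ ^ 2 * inner ℝ (Fi - F₀) w + τ ^ 2 * inner ℝ (F₀ - R j₀ F₀) w
      - τ ^ 2 * ∑ j, inner ℝ (b j - R j (b j)) w
      + inner ℝ ((x₀ - xi) - S (x₀ - xi)) w + inner ℝ ((x₀ - xm) - S (x₀ - xm)) w := by
    -- Splitting 2x₀ − xm = (x₀ − xi) + (x₀ − xm) + xi isolates (1−S)xi = τ² Σ R_j b_j, which pairs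
    -- with the −τ² Σ b_j of the second difference.
    have e : xp - S ((2 : ℝ) • x₀ - xm) - τ ^ 2 • R j₀ F₀ =
        (xp - (2 : ℝ) • x₀ + xm) + ((x₀ - xi) - S (x₀ - xi)) + ((x₀ - xm) - S (x₀ - xm))
          + (xi - S xi) - τ ^ 2 • R j₀ F₀ := by
      simp only [map_sub, two_smul, map_add]
      abel
    rw [e, hDi, ← sum_inner, Finset.sum_sub_distrib]
    simp only [inner_add_left, inner_sub_left, inner_smul_left, RCLike.conj_to_real] at hsecond ⊢
    linarith
  have t1 : |τ ^ 2 * inner ℝ (Fi - F₀) w| ≤ τ ^ 2 * γ * ‖w‖ := by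
    rw [abs_mul, abs_of_nonneg (sq_nonneg τ), mul_assoc]
    refine mul_le_mul_of_nonneg_left ((abs_real_inner_le_norm _ _).trans ?_) (sq_nonneg τ)
    exact mul_le_mul_of_nonneg_right hF (norm_nonneg w)
  have t2 : |τ ^ 2 * inner ℝ (F₀ - R j₀ F₀) w| ≤ τ ^ 2 * ((√(η j₀))⁻¹ * CF * q) := by
    rw [abs_mul, abs_of_nonneg (sq_nonneg τ)]
    refine mul_le_mul_of_nonneg_left ((abs_defect_le_convexSum hR hη hsum j₀ F₀ w).trans ?_)
      (sq_nonneg τ)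
    gcongr
  have t3 : |τ ^ 2 * ∑ j, inner ℝ (b j - R j (b j)) w| ≤
      τ ^ 2 * ((∑ j, (√(η j))⁻¹ * Ca) * q) := by
    rw [abs_mul, abs_of_nonneg (sq_nonneg τ), Finset.sum_mul]
    refine mul_le_mul_of_nonneg_left ((Finset.abs_sum_le_sum_abs _ _).trans
      (Finset.sum_le_sum fun j _ => ?_)) (sq_nonneg τ)
    refine (abs_defect_le_convexSum hR hη hsum j (b j) w).trans ?_
    have := hCa j
    gcongr
  have t4 : |inner ℝ ((x₀ - xi) - S (x₀ - xi)) w| ≤ κ * q :=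
    (hSf.abs_defect_le _ _).trans (mul_le_mul_of_nonneg_right h1 hq0)
  have t5 : |inner ℝ ((x₀ - xm) - S (x₀ - xm)) w| ≤ κ * q :=
    (hSf.abs_defect_le _ _).trans (mul_le_mul_of_nonneg_right h2 hq0)
  rw [key]
  rw [abs_le] at *
  constructor <;> linarith

end Residual

/-! ### Unbounded operators, resolvents and relative bounds -/

section Operators

variable {𝕜 H : Type*} [RCLike 𝕜] [NormedAddCommGroup H] [InnerProductSpace 𝕜 H]

theorem opApply_of_mem {A : H →ₗ.[𝕜] H} {x : H} (hx : x ∈ A.domain) : opApply A x = A ⟨x, hx⟩ :=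
  dif_pos hx

theorem opApply_of_mem_graph {A : H →ₗ.[𝕜] H} {x y : H} (h : (x, y) ∈ A.graph) :
    opApply A x = y := by
  obtain ⟨a, ha, ha'⟩ := (LinearPMap.mem_graph_iff A).1 h
  simp only at ha ha'
  subst ha
  rw [opApply_of_mem a.2, ← ha']

theorem opApply_mem_graph {A : H →ₗ.[𝕜] H} {x : H} (hx : x ∈ A.domain) :
    (x, opApply A x) ∈ A.graph := by
  rw [opApply_of_mem hx]
  exact LinearPMap.mem_graph A ⟨x, hx⟩

theorem opApply_sub {A : H →ₗ.[𝕜] H} {x y : H} (hx : x ∈ A.domain) (hy : y ∈ A.domain) :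
    opApply A (x - y) = opApply A x - opApply A y :=
  opApply_of_mem_graph (A.graph.sub_mem (opApply_mem_graph hx) (opApply_mem_graph hy))

theorem mem_domain_sum {ι : Type*} (s : Finset ι) (B : ι → H →ₗ.[𝕜] H) {x : H} :
    x ∈ (∑ j ∈ s, B j).domain ↔ ∀ j ∈ s, x ∈ (B j).domain := by
  classical
  induction s using Finset.induction_on with
  | empty => simp
  | insert i s hi ih =>
    rw [Finset.sum_insert hi, LinearPMap.add_domain, Submodule.mem_inf, ih]
    simp

theorem opApply_sum {ι : Type*} (s : Finset ι) (B : ι → H →ₗ.[𝕜] H) {x : H}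
    (hx : ∀ j ∈ s, x ∈ (B j).domain) :
    opApply (∑ j ∈ s, B j) x = ∑ j ∈ s, opApply (B j) x := by
  classical
  induction s using Finset.induction_on with
  | empty =>
    rw [Finset.sum_empty, Finset.sum_empty, opApply_of_mem (A := (0 : H →ₗ.[𝕜] H)) (x := x) trivial]
    rfl
  | insert i s hi ih =>
    have h1 : x ∈ (∑ j ∈ s, B j).domain :=
      (mem_domain_sum s B).2 fun j hj => hx j (Finset.mem_insert_of_mem hj)
    have h2 : x ∈ (B i).domain := hx i (Finset.mem_insert_self i s)
    rw [Finset.sum_insert hi, Finset.sum_insert hi,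
      ← ih fun j hj => hx j (Finset.mem_insert_of_mem hj)]
    rw [opApply_of_mem (A := B i + ∑ j ∈ s, B j) ⟨h2, h1⟩, opApply_of_mem h1, opApply_of_mem h2]
    rfl

theorem re_inner_opApply_nonneg {A : H →ₗ.[𝕜] H} (hpos : IsPositiveDefinite A) {x : H}
    (hx : x ∈ A.domain) : 0 ≤ RCLike.re (inner 𝕜 (opApply A x) x) := by
  obtain ⟨α, hα, h⟩ := hpos
  rw [opApply_of_mem hx]
  exact le_trans (by positivity) (h ⟨x, hx⟩)

/-- The operator `1 + c A` on `D(A)`. -/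
noncomputable def oneAddSMul (c : ℝ) (A : H →ₗ.[𝕜] H) : H →ₗ.[𝕜] H :=
  (LinearMap.id : H →ₗ[𝕜] H) +ᵥ ((c : 𝕜) • A)

theorem mem_graph_oneAddSMul (c : ℝ) (A : H →ₗ.[𝕜] H) {x y : H} :
    (x, y) ∈ (oneAddSMul c A).graph ↔ x ∈ A.domain ∧ x + (c : 𝕜) • opApply A x = y := by
  rw [LinearPMap.mem_graph_iff]
  constructor
  · rintro ⟨a, rfl, h⟩
    refine ⟨a.2, ?_⟩
    rw [opApply_of_mem (A := A) a.2]
    exact h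
  · rintro ⟨hx, h⟩
    refine ⟨⟨x, hx⟩, rfl, ?_⟩
    rw [opApply_of_mem hx] at h
    exact h

variable [CompleteSpace H]

theorem inner_opApply_symm {A : H →ₗ.[𝕜] H} (hA : IsSelfAdjoint A) {x y : H}
    (hx : x ∈ A.domain) (hy : y ∈ A.domain) :
    inner 𝕜 (opApply A x) y = inner 𝕜 x (opApply A y) := by
  have h1 : A.IsFormalAdjoint A := by
    have := LinearPMap.adjoint_isFormalAdjoint hA.dense_domain
    rwa [LinearPMap.isSelfAdjoint_def.1 hA] at this
  rw [opApply_of_mem hx, opApply_of_mem hy]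
  exact h1 ⟨x, hx⟩ ⟨y, hy⟩

/-- `(A x, x) = ‖A^{1/2} x‖²` on `D(A)`. -/
theorem re_inner_opApply_eq_sqrtOp {A : H →ₗ.[𝕜] H} (hA : IsSelfAdjoint A)
    (hpos : IsPositiveDefinite A) {x : H} (hx : x ∈ A.domain) :
    RCLike.re (inner 𝕜 (opApply A x) x) = ‖opApply (sqrtOp A) x‖ ^ 2 := by
  have hR := isPosSqrt_sqrtOp hA hpos
  obtain ⟨z, hz, hz'⟩ := (hR.sq x (opApply A x)).1 (opApply_mem_graph hx)
  have h := inner_opApply_symm hR.isSelfAdjoint (LinearPMap.mem_domain_of_mem_graph hz')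
    (LinearPMap.mem_domain_of_mem_graph hz)
  rw [opApply_of_mem_graph hz, opApply_of_mem_graph hz'] at h
  rw [h, opApply_of_mem_graph hz, inner_self_eq_norm_sq]

theorem isSelfAdjoint_oneAddSMul {A : H →ₗ.[𝕜] H} (hA : IsSelfAdjoint A) {c : ℝ} (hc : 0 < c) :
    IsSelfAdjoint (oneAddSMul c A) := by
  have hc' : (c : 𝕜) ≠ 0 := by exact_mod_cast hc.ne'
  have hdense : Dense ((oneAddSMul c A).domain : Set H) := hA.dense_domain
  rw [LinearPMap.isSelfAdjoint_def]
  refine LinearPMap.eq_of_eq_graph ?_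
  rw [LinearPMap.adjoint_graph_eq_graph_adjoint hdense]
  ext ⟨p, q⟩
  rw [Submodule.mem_adjoint_iff, mem_graph_oneAddSMul]
  constructor
  · intro h
    -- If (p, q) is in the adjoint graph of 1 + cA, the only candidate for Ap is c⁻¹(q − p);
    -- self-adjointness of A confirms it.
    have h1 : (p, (c : 𝕜)⁻¹ • (q - p)) ∈ A.graph := by
      have h2 : A.adjoint.graph = A.graph := by rw [LinearPMap.isSelfAdjoint_def.1 hA]
      rw [← h2, LinearPMap.adjoint_graph_eq_graph_adjoint hA.dense_domain,
        Submodule.mem_adjoint_iff]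
      intro a b hab
      have h3 := h a (a + (c : 𝕜) • b) ((mem_graph_oneAddSMul c A).2
        ⟨LinearPMap.mem_domain_of_mem_graph hab, by rw [opApply_of_mem_graph hab]⟩)
      rw [inner_add_left, inner_smul_left, RCLike.conj_ofReal] at h3
      rw [inner_smul_right, inner_sub_right]
      field_simp
      linear_combination h3
    refine ⟨LinearPMap.mem_domain_of_mem_graph h1, ?_⟩
    rw [opApply_of_mem_graph h1, smul_smul, mul_inv_cancel₀ hc', one_smul]
    abel
  · rintro ⟨hp, rfl⟩ a b hab
    obtain ⟨ha, rfl⟩ := (mem_graph_oneAddSMul c A).1 hab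
    rw [inner_add_left, inner_add_right, inner_smul_left, inner_smul_right, RCLike.conj_ofReal,
      inner_opApply_symm hA ha hp, sub_self]

/-- The resolvent `(1 + c A)⁻¹` of a positive definite self-adjoint operator. -/
theorem exists_resolvent {A : H →ₗ.[𝕜] H} (hA : IsSelfAdjoint A) (hpos : IsPositiveDefinite A)
    {c : ℝ} (hc : 0 < c) :
    ∃ G : H →L[𝕜] H, ∀ x y, (x ∈ A.domain ∧ x + (c : 𝕜) • opApply A x = y) ↔ G y = x := by
  obtain ⟨G, hG⟩ := exists_bounded_inverse (isSelfAdjoint_oneAddSMul hA hc) one_pos (by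
    intro x
    have hx : (x : H) ∈ A.domain := x.2
    have h := opApply_of_mem_graph (LinearPMap.mem_graph (oneAddSMul c A) x)
    have h2 := opApply_of_mem_graph ((mem_graph_oneAddSMul c A).2 ⟨hx, rfl⟩)
    rw [← h, h2, inner_add_left, inner_smul_left, RCLike.conj_ofReal, map_add,
      RCLike.re_ofReal_mul, inner_self_eq_norm_sq]
    have := mul_nonneg hc.le (re_inner_opApply_nonneg hpos hx)
    linarith)
  exact ⟨G, fun x y => by rw [← hG, mem_graph_oneAddSMul]⟩

/-- A closed operator `B` with `D(A) ⊆ D(B)` is bounded relative to `A`. -/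
theorem exists_relative_bound {A B : H →ₗ.[𝕜] H} (hA : IsSelfAdjoint A)
    (hpos : IsPositiveDefinite A) (hB : IsSelfAdjoint B) (hAB : A.domain ≤ B.domain) :
    ∃ C : ℝ, 0 ≤ C ∧ ∀ x ∈ A.domain, ‖opApply B x‖ ≤ C * ‖opApply A x‖ := by
  obtain ⟨α, hα, hpos⟩ := hpos
  obtain ⟨G, hG⟩ := exists_bounded_inverse hA hα hpos
  have hmem : ∀ y, G y ∈ B.domain := fun y =>
    hAB (LinearPMap.mem_domain_of_mem_graph ((hG (G y) y).2 rfl))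
  let L : H →ₗ[𝕜] H := B.toFun.comp ((G : H →ₗ[𝕜] H).codRestrict B.domain hmem)
  have hL : ∀ y, (G y, L y) ∈ B.graph := fun y => LinearPMap.mem_graph B ⟨G y, hmem y⟩
  -- L = B A⁻¹ is defined everywhere, and its graph is the preimage of the closed graph of B under a
  -- continuous map; the closed graph theorem makes it bounded.
  have hgraph : ((L.graph : Submodule 𝕜 (H × H)) : Set (H × H)) =
      (fun p : H × H => (G p.1, p.2)) ⁻¹' (B.graph : Set (H × H)) := by
    ext ⟨y, z⟩
    simp only [SetLike.mem_coe, LinearMap.mem_graph_iff, Set.mem_preimage]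
    constructor
    · rintro rfl
      exact hL y
    · intro h
      rw [← opApply_of_mem_graph h, opApply_of_mem_graph (hL y)]
  let Lc : H →L[𝕜] H := ContinuousLinearMap.ofIsClosedGraph (g := L) (by
    rw [hgraph]
    exact IsClosed.preimage (by fun_prop) hB.isClosed)
  refine ⟨‖Lc‖, norm_nonneg _, fun x hx => ?_⟩
  have h1 : G (opApply A x) = x := (hG _ _).1 (opApply_mem_graph hx)
  have h2 : Lc (opApply A x) = opApply B x := by
    have := opApply_of_mem_graph (hL (opApply A x))
    rw [h1] at this
    exact this.symm
  rw [← h2]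
  exact Lc.le_opNorm _

end Operators

/-! ### Consistency, summation and the error bound -/

section Convergence

variable {E : Type*} [NormedAddCommGroup E] [InnerProductSpace ℝ E] {ι : Type*} [Fintype ι]
  {η : ι → ℝ} {T : ℝ} {u F : ℝ → E} {b : ι → ℝ → E} {lam KF CF Ca K : ℝ}

/-- Since 1 − S ≤ τ²A as forms, the seminorm of an increment of u is at most τ ‖A^{1/2}(u(t) −
u(s))‖; this is where the Hölder condition on A^{1/2}u enters. -/
theorem sqrt_defect_sub_le (hη : ∀ j, 0 < η j) (hsum : ∑ j, η j = 1) {R : ι → E →ₗ[ℝ] E}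
    (hR : ∀ j, IsFirm (R j)) (hlam : 0 ≤ lam) (hK : 0 ≤ K) {τ t s : ℝ} (hτ : 0 < τ)
    (henergy : inner ℝ (∑ j, (b j t - b j s)) (u t - u s) ≤ (K * |t - s| ^ lam) ^ 2)
    (ht : ∀ j, (τ ^ 2 / η j) • R j (b j t) = u t - R j (u t))
    (hs : ∀ j, (τ ^ 2 / η j) • R j (b j s) = u s - R j (u s)) (hts : |t - s| ≤ τ) :
    √(inner ℝ ((u t - u s) - (∑ j, η j • R j) (u t - u s)) (u t - u s)) ≤ τ * (K * τ ^ lam) := by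
  have h := defect_convexSum_le_of_resolvent hR hη hsum (τ := τ) (x := u t - u s)
    (b := fun j => b j t - b j s) fun j => by
      rw [map_sub, smul_sub, ht, hs, map_sub]; abel
  rw [Real.sqrt_le_left (by positivity)]
  refine h.trans ?_
  rw [mul_pow]
  refine mul_le_mul_of_nonneg_left (henergy.trans ?_) (sq_nonneg τ)
  have : |t - s| ^ lam ≤ τ ^ lam := Real.rpow_le_rpow (abs_nonneg _) hts hlam
  gcongr

/-- The truncation error of the scheme, tested against a vector. -/
theorem truncation_le (j₀ : ι) (hη : ∀ j, 0 < η j) (hsum : ∑ j, η j = 1)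
    (hu : ContDiffOn ℝ 2 u (Set.Icc 0 T))
    (heq : ∀ t ∈ Set.Icc 0 T,
      iteratedDerivWithin 2 u (Set.Icc 0 T) t + ∑ j, b j t = F t)
    (hlam : 0 ≤ lam) (hKF : 0 ≤ KF) (hK : 0 ≤ K)
    (hF : ∀ t ∈ Set.Icc 0 T, ∀ s ∈ Set.Icc 0 T, ‖F t - F s‖ ≤ KF * |t - s| ^ lam)
    (hCF : ∀ t ∈ Set.Icc 0 T, ‖F t‖ ≤ CF)
    (hCa : ∀ t ∈ Set.Icc 0 T, ∀ j, ‖b j t‖ ≤ Ca)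
    (henergy : ∀ t ∈ Set.Icc 0 T, ∀ s ∈ Set.Icc 0 T,
      inner ℝ (∑ j, (b j t - b j s)) (u t - u s) ≤ (K * |t - s| ^ lam) ^ 2)
    {R : ι → E →ₗ[ℝ] E} (hR : ∀ j, IsFirm (R j)) {τ : ℝ} (hτ : 0 < τ)
    (hRb : ∀ j, ∀ t ∈ Set.Icc 0 T, (τ ^ 2 / η j) • R j (b j t) = u t - R j (u t))
    {t : ℝ} (ht0 : 0 ≤ t - τ) (htT : t + τ ≤ T) (w : E) :
    |inner ℝ (u (t + τ) - (∑ j, η j • R j) ((2 : ℝ) • u t - u (t - τ)) - τ ^ 2 • R j₀ (F t)) w| ≤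
      (τ ^ 2 * ((√(η j₀))⁻¹ * CF + ∑ j, (√(η j))⁻¹ * Ca) + 2 * (τ * (K * τ ^ lam)))
        * √(inner ℝ (w - (∑ j, η j • R j) w) w) + τ ^ 2 * (KF * τ ^ lam) * ‖w‖ := by
  have hsub : ∀ x ∈ Set.Ioo (t - τ) (t + τ), x ∈ Set.Ioo 0 T := fun x hx =>
    ⟨ht0.trans_lt hx.1, hx.2.trans_le htT⟩
  have ht : t ∈ Set.Icc 0 T := ⟨by linarith, by linarith⟩
  have htm : t - τ ∈ Set.Icc 0 T := ⟨by linarith, by linarith⟩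
  -- The point ξ depends on w, which is harmless because all bounds below are uniform in ξ.
  obtain ⟨ξ, hξ, h2⟩ := exists_second_difference_eq (φ := fun s => inner ℝ (u s) w)
    (φ' := fun s => inner ℝ (derivWithin u (Set.Icc 0 T) s) w)
    (φ'' := fun s => inner ℝ (iteratedDerivWithin 2 u (Set.Icc 0 T) s) w) hτ
    ((hu.continuousOn.mono (Set.Icc_subset_Icc ht0 htT)).inner continuousOn_const)
    (fun x hx => by
      simpa using (hasDerivAt_of_contDiffOn_two hu (hsub x hx)).1.inner ℝ (hasDerivAt_const x w))
    (fun x hx => by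
      simpa using (hasDerivAt_of_contDiffOn_two hu (hsub x hx)).2.inner ℝ (hasDerivAt_const x w))
  have hξI : ξ ∈ Set.Icc 0 T := Set.Ioo_subset_Icc_self (hsub ξ hξ)
  have hξt : |ξ - t| ≤ τ := by
    rw [abs_le]
    constructor <;> linarith [hξ.1, hξ.2]
  refine residual_le hR hη hsum j₀ (xi := u ξ) (Fi := F ξ) (b := fun j => b j ξ) ?_
    (fun j => hRb j ξ hξI) ?_ (hCF t ht) (hCa ξ hξI) ?_ ?_
  · rw [← heq ξ hξI, add_sub_cancel_right, ← h2, inner_add_left, inner_sub_left,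
      real_inner_smul_left]
  · refine (hF ξ hξI t ht).trans ?_
    have : |ξ - t| ^ lam ≤ τ ^ lam := Real.rpow_le_rpow (abs_nonneg _) hξt hlam
    gcongr
  · exact sqrt_defect_sub_le hη hsum hR hlam hK hτ (henergy t ht ξ hξI)
      (fun j => hRb j t ht) (fun j => hRb j ξ hξI) (by rwa [abs_sub_comm])
  · refine sqrt_defect_sub_le hη hsum hR hlam hK hτ (henergy t ht _ htm)
      (fun j => hRb j t ht) (fun j => hRb j _ htm) ?_
    rw [sub_sub_cancel, abs_of_pos hτ]

/-- Convergence of the scheme written in terms of the resolvents `R j = (1 + (τ² / η j) A j)⁻¹`,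
for a solution `u` with `b j t = A j (u t)`. -/
theorem exists_error_bound (j₀ : ι) (hη : ∀ j, 0 < η j) (hsum : ∑ j, η j = 1) (hT : 0 < T)
    (hu : ContDiffOn ℝ 2 u (Set.Icc 0 T))
    (heq : ∀ t ∈ Set.Icc 0 T,
      iteratedDerivWithin 2 u (Set.Icc 0 T) t + ∑ j, b j t = F t)
    (hlam : 0 ≤ lam) (hlam1 : lam ≤ 1) (hKF : 0 ≤ KF) (hK : 0 ≤ K)
    (hF : ∀ t ∈ Set.Icc 0 T, ∀ s ∈ Set.Icc 0 T, ‖F t - F s‖ ≤ KF * |t - s| ^ lam)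
    (hCF : ∀ t ∈ Set.Icc 0 T, ‖F t‖ ≤ CF)
    (hCa : ∀ t ∈ Set.Icc 0 T, ∀ j, ‖b j t‖ ≤ Ca)
    (henergy : ∀ t ∈ Set.Icc 0 T, ∀ s ∈ Set.Icc 0 T,
      inner ℝ (∑ j, (b j t - b j s)) (u t - u s) ≤ (K * |t - s| ^ lam) ^ 2)
    {a : ℝ} (ha : 0 ≤ a) :
    ∃ C : ℝ, 0 < C ∧ ∀ n : ℕ, 1 < n → ∀ (R : ι → E →ₗ[ℝ] E) (v g : ℕ → E),
      (∀ j, IsFirm (R j)) →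
      (∀ j, ∀ t ∈ Set.Icc 0 T, ((T / n) ^ 2 / η j) • R j (b j t) = u t - R j (u t)) →
      v 0 = u 0 → v 1 = u 0 + (T / n) • derivWithin u (Set.Icc 0 T) 0 →
      (∀ k, 1 ≤ k → k + 1 ≤ n → v (k + 1) =
        (∑ j, η j • R j) ((2 : ℝ) • v k - v (k - 1)) + (T / n) ^ 2 • R j₀ (g k)) →
      (∀ k, k ≤ n → ‖F (k * (T / n)) - g k‖ ≤ a * ‖u (k * (T / n)) - v k‖) →
      ∀ k : ℕ, k ≤ n → ‖u (k * (T / n)) - v k‖ ≤ C * (T / n) ^ lam := by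
  obtain ⟨Cu, hCu0, hCu⟩ := exists_first_step_bound hT hu
  have h0I : (0 : ℝ) ∈ Set.Icc 0 T := ⟨le_rfl, hT.le⟩
  have hCF0 : 0 ≤ CF := (norm_nonneg _).trans (hCF 0 h0I)
  have hCa0 : 0 ≤ Ca := (norm_nonneg _).trans (hCa 0 h0I j₀)
  set c₁ : ℝ := (√(η j₀))⁻¹ * CF + ∑ j, (√(η j))⁻¹ * Ca with hc₁
  have hc₁0 : 0 ≤ c₁ := by positivity
  set P : ℝ := T ^ (1 - lam) with hP
  have hP0 : 0 ≤ P := by positivity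
  -- The four terms come from the first step, the resolvent defects, the increments of A^{1/2}u and
  -- the Hölder modulus of F; P converts τ into τ^λ.
  set C₀ : ℝ := Cu * T * P + T * P * c₁ + 2 * K * T + T ^ 2 * KF with hC₀
  have hC₀0 : 0 ≤ C₀ := by positivity
  -- The exponential is the Gronwall factor; the added 1 only ensures positivity. The constant is
  -- fixed before n and the resolvents.
  refine ⟨C₀ * Real.exp (T ^ 2 * a) + 1, by positivity, ?_⟩
  intro n hn R v g hR hRb hv0 hv1 hstep hg
  have hn0 : (0 : ℝ) < n := by exact_mod_cast (by omega : 0 < n)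
  set τ : ℝ := T / n with hτdef
  have hτ : 0 < τ := div_pos hT hn0
  have hnτ : n * τ = T := by rw [hτdef]; field_simp
  have hτT : τ ≤ T := by
    have : (1 : ℝ) ≤ n := by exact_mod_cast hn.le
    nlinarith
  have hτP : τ ≤ P * τ ^ lam := by
    have h1 : τ = τ ^ (1 - lam) * τ ^ lam := by
      rw [← Real.rpow_add hτ]; simp
    have h2 : τ ^ (1 - lam) ≤ P := Real.rpow_le_rpow hτ.le hτT (by linarith)
    calc τ = τ ^ (1 - lam) * τ ^ lam := h1
      _ ≤ P * τ ^ lam := by gcongr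
  set L : ℝ := τ ^ lam with hL
  have hL0 : 0 ≤ L := by positivity
  set S := ∑ j, η j • R j with hS
  have hSf : IsFirm S := IsFirm.convexSum hR (fun j => (hη j).le) hsum
  set z : ℕ → E := fun k => u (k * τ) - v k with hz
  have hz0 : z 0 = 0 := by simp [hz, hv0]
  have hz1 : ‖z 1‖ ≤ Cu * τ ^ 2 := by
    simp only [hz, Nat.cast_one, one_mul, hv1]
    exact hCu τ ⟨hτ.le, hτT⟩
  have hρ : ∀ i, i + 2 ≤ n → ∀ w, |inner ℝ (z (i + 2) - S ((2 : ℝ) • z (i + 1) - z i)) w| ≤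
      (τ ^ 2 * c₁ + 2 * (τ * (K * L))) * √(inner ℝ (w - S w) w)
        + (τ ^ 2 * (KF * L) + τ ^ 2 * (a * ‖z (i + 1)‖)) * ‖w‖ := by
    intro i hi w
    have hi' : (i : ℝ) + 2 ≤ n := by exact_mod_cast hi
    have h1 := truncation_le j₀ hη hsum hu heq hlam hKF hK hF hCF hCa henergy hR hτ hRb
      (t := ((i + 1 : ℕ) : ℝ) * τ) (by push_cast; nlinarith [(Nat.cast_nonneg i : (0 : ℝ) ≤ i)])
      (by push_cast; nlinarith) w
    have e1 : ((i + 1 : ℕ) : ℝ) * τ + τ = ((i + 2 : ℕ) : ℝ) * τ := by push_cast; ring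
    have e2 : ((i + 1 : ℕ) : ℝ) * τ - τ = (i : ℝ) * τ := by push_cast; ring
    rw [e1, e2] at h1
    have h2 : z (i + 2) - S ((2 : ℝ) • z (i + 1) - z i) =
        (u ((i + 2 : ℕ) * τ) - S ((2 : ℝ) • u ((i + 1 : ℕ) * τ) - u (i * τ))
          - τ ^ 2 • R j₀ (F ((i + 1 : ℕ) * τ)))
        + τ ^ 2 • R j₀ (F ((i + 1 : ℕ) * τ) - g (i + 1)) := by
      have h3 := hstep (i + 1) (by omega) (by omega)
      rw [Nat.add_sub_cancel] at h3
      simp only [hz]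
      rw [show v (i + 2) = v (i + 1 + 1) from rfl, h3]
      simp only [map_sub, two_smul, map_add, smul_sub]
      abel
    have h4 : |inner ℝ (τ ^ 2 • R j₀ (F ((i + 1 : ℕ) * τ) - g (i + 1))) w| ≤
        τ ^ 2 * (a * ‖z (i + 1)‖) * ‖w‖ := by
      refine (abs_real_inner_le_norm _ _).trans
        (mul_le_mul_of_nonneg_right ?_ (norm_nonneg w))
      rw [norm_smul, Real.norm_of_nonneg (sq_nonneg τ)]
      exact mul_le_mul_of_nonneg_left
        (((hR j₀).norm_le _).trans (hg (i + 1) (by omega))) (sq_nonneg τ)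
    rw [h2, inner_add_left]
    refine (abs_add_le _ _).trans ((add_le_add h1 h4).trans_eq ?_)
    ring
  have hsumle : ∀ k ≤ n, ‖z k‖ ≤ C₀ * L + T * a * τ * ∑ i ∈ Finset.range k, ‖z i‖ := by
    intro k hk
    cases k with
    | zero => rw [hz0]; simp; positivity
    | succ k =>
      have hkn : (k : ℝ) + 1 ≤ n := by exact_mod_cast hk
      have h1 := hSf.norm_le_of_recurrence z hz0 k
        (fun _ => τ ^ 2 * c₁ + 2 * (τ * (K * L)))
        (fun i => τ ^ 2 * (KF * L) + τ ^ 2 * (a * ‖z (i + 1)‖))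
        (fun _ _ => by positivity) (fun _ _ => by positivity)
        (fun i hi => hρ i (by omega))
      rw [Finset.sum_range_succ', hz0, norm_zero, add_zero]
      refine h1.trans ?_
      have h2 : ((k : ℝ) + 1) * ‖z 1‖ ≤ n * (Cu * τ ^ 2) := by gcongr
      -- Only the norm part carries k + 1 ≤ n, and nτ² = Tτ leaves one power of τ for the sum over
      -- i; the form part needs no such loss.
      have h3 : ∑ i ∈ Finset.range k, (τ ^ 2 * c₁ + 2 * (τ * (K * L))
          + (k + 1) * (τ ^ 2 * (KF * L) + τ ^ 2 * (a * ‖z (i + 1)‖))) ≤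
          ∑ i ∈ Finset.range k, ((τ ^ 2 * c₁ + 2 * (τ * (K * L)) + T * τ * (KF * L))
            + T * τ * a * ‖z (i + 1)‖) := by
        refine Finset.sum_le_sum fun i _ => ?_
        have h4 : ((k : ℝ) + 1) * (τ ^ 2 * (KF * L) + τ ^ 2 * (a * ‖z (i + 1)‖)) ≤
            n * (τ ^ 2 * (KF * L) + τ ^ 2 * (a * ‖z (i + 1)‖)) := by gcongr
        refine (add_le_add_right h4 _).trans_eq ?_
        rw [← hnτ]
        ring
      have h5 : (k : ℝ) * (τ ^ 2 * c₁ + 2 * (τ * (K * L)) + T * τ * (KF * L)) ≤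
          n * (τ ^ 2 * c₁ + 2 * (τ * (K * L)) + T * τ * (KF * L)) := by
        gcongr
        linarith
      have h3' : ∑ i ∈ Finset.range k, ((τ ^ 2 * c₁ + 2 * (τ * (K * L)) + T * τ * (KF * L))
            + T * τ * a * ‖z (i + 1)‖) =
          k * (τ ^ 2 * c₁ + 2 * (τ * (K * L)) + T * τ * (KF * L))
            + T * a * τ * ∑ i ∈ Finset.range k, ‖z (i + 1)‖ := by
        rw [Finset.sum_add_distrib, Finset.sum_const, Finset.card_range, nsmul_eq_mul,
          ← Finset.mul_sum]
        ring
      have h6 : n * (Cu * τ ^ 2) = Cu * T * τ := by rw [← hnτ]; ring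
      have h7 : n * (τ ^ 2 * c₁ + 2 * (τ * (K * L)) + T * τ * (KF * L)) =
          T * c₁ * τ + 2 * K * T * L + T ^ 2 * KF * L := by rw [← hnτ]; ring
      have h8 : Cu * T * τ ≤ Cu * T * (P * L) := by gcongr
      have h9 : T * c₁ * τ ≤ T * c₁ * (P * L) := by gcongr
      have h10 : C₀ * L = Cu * T * (P * L) + T * c₁ * (P * L) + 2 * K * T * L + T ^ 2 * KF * L := by
        rw [hC₀]; ring
      linarith
  intro k hk
  have h1 := discrete_gronwall (by positivity : 0 ≤ T * a * τ) hsumle hk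
  have h2 : (1 + T * a * τ) ^ k ≤ Real.exp (T ^ 2 * a) := by
    have h3 : 1 + T * a * τ ≤ Real.exp (T * a * τ) := by
      linarith [Real.add_one_le_exp (T * a * τ)]
    refine (pow_le_pow_left₀ (by positivity) h3 k).trans ?_
    rw [← Real.exp_nat_mul]
    refine Real.exp_le_exp.2 ?_
    have hk' : (k : ℝ) ≤ n := by exact_mod_cast hk
    calc (k : ℝ) * (T * a * τ) ≤ n * (T * a * τ) := by gcongr
      _ = T ^ 2 * a := by rw [sq, ← hnτ]; ring
  have h3 : C₀ * L * (1 + T * a * τ) ^ k ≤ C₀ * L * Real.exp (T ^ 2 * a) := by gcongr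
  have h4 : (C₀ * Real.exp (T ^ 2 * a) + 1) * L = C₀ * L * Real.exp (T ^ 2 * a) + L := by ring
  rw [h4]
  exact h1.trans (h3.trans (by linarith))

end Convergence

/-! ### Hölder estimates on [0, T] -/

section Scheme

variable {𝕜 H : Type*} [RCLike 𝕜] [NormedAddCommGroup H] [InnerProductSpace 𝕜 H]

theorem abs_le_mul_rpow {T t lam : ℝ} (ht : |t| ≤ T) (hlam1 : lam ≤ 1) :
    |t| ≤ T ^ (1 - lam) * |t| ^ lam := by
  rcases (abs_nonneg t).eq_or_lt with h | h
  · rw [← h] at ht ⊢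
    positivity
  · calc |t| = |t| ^ (1 - lam) * |t| ^ lam := by rw [← Real.rpow_add h]; simp
      _ ≤ T ^ (1 - lam) * |t| ^ lam := by
        have := Real.rpow_le_rpow h.le ht (by linarith : 0 ≤ 1 - lam)
        gcongr

theorem norm_sub_le_of_holderOnWith {K lam : ℝ≥0} {g : ℝ → H} {s : Set ℝ}
    (hg : HolderOnWith K lam g s) {x y : ℝ} (hx : x ∈ s) (hy : y ∈ s) :
    ‖g x - g y‖ ≤ K * |x - y| ^ (lam : ℝ) := by
  rw [← dist_eq_norm, ← Real.dist_eq]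
  exact hg.dist_le hx hy

theorem exists_bound_of_holder {g : ℝ → H} {T K lam : ℝ} (hT : 0 < T) (hlam : 0 ≤ lam)
    (hK : 0 ≤ K) (h : ∀ t ∈ Set.Icc 0 T, ∀ s ∈ Set.Icc 0 T, ‖g t - g s‖ ≤ K * |t - s| ^ lam) :
    ∃ C, ∀ t ∈ Set.Icc 0 T, ‖g t‖ ≤ C := by
  refine ⟨‖g 0‖ + K * T ^ lam, fun t ht => ?_⟩
  have h1 := h t ht 0 ⟨le_rfl, hT.le⟩
  have h2 : |t - 0| ^ lam ≤ T ^ lam := by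
    rw [sub_zero, abs_of_nonneg ht.1]
    exact Real.rpow_le_rpow ht.1 ht.2 hlam
  have h3 := mul_le_mul_of_nonneg_left h2 hK
  have h4 := norm_le_norm_add_norm_sub' (g t) (g 0)
  linarith

end Scheme

/-! ### From the scheme to the resolvent recurrence, over the underlying real space -/

section Real

variable {𝕜 H : Type*} [RCLike 𝕜] [NormedAddCommGroup H] [InnerProductSpace 𝕜 H]
  [InnerProductSpace ℝ H] [IsScalarTower ℝ 𝕜 H]

/-- The scheme in terms of the resolvents `R j = (1 + (τ² / η j) A j)⁻¹`. -/
theorem IsSchemeSolution.eq_resolvent {m : ℕ} (hm : 0 < m) {Aj : Fin m → H →ₗ.[𝕜] H}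
    {η : Fin m → ℝ} (hη : ∀ j, 0 < η j) {M : H → H} {f : ℝ → H} {φ₀ φ₁ : H} {τ : ℝ} (hτ : 0 < τ)
    {n : ℕ} {v : ℕ → H} {y : Fin m → ℕ → H} (hv : IsSchemeSolution Aj η M f φ₀ φ₁ τ n v y)
    {G : Fin m → H →L[𝕜] H}
    (hG : ∀ j x y, (x ∈ (Aj j).domain ∧ x + ((τ ^ 2 / η j : ℝ) : 𝕜) • opApply (Aj j) x = y) ↔
      G j y = x) {k : ℕ} (hk1 : 1 ≤ k) (hkn : k + 1 ≤ n) :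
    v (k + 1) = (∑ j, η j • ((G j : H →ₗ[𝕜] H).restrictScalars ℝ)) ((2 : ℝ) • v k - v (k - 1))
      + τ ^ 2 • ((G ⟨0, hm⟩ : H →ₗ[𝕜] H).restrictScalars ℝ) (f (k * τ) - M (v k)) := by
  set g := f (k * τ) - M (v k) with hg
  have hy : ∀ j, y j (k + 1) = ((G j : H →ₗ[𝕜] H).restrictScalars ℝ)
      (((2 : ℝ) • v k - v (k - 1)) + (τ ^ 2 / η j) • if j = ⟨0, hm⟩ then g else 0) := by
    intro j
    refine ((hG j _ _).1 ⟨hv.mem_domain k hk1 hkn j, ?_⟩).symm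
    have h := hv.step k hk1 hkn j
    have e : ((j : ℕ) = 0) = (j = ⟨0, hm⟩) := by rw [Fin.ext_iff]
    simp only [e] at h
    rw [← hg] at h
    rw [← h, ← RCLike.real_smul_eq_coe_smul (K := 𝕜), smul_add, smul_smul]
    have e2 : τ ^ 2 / η j * (η j / τ ^ 2) = 1 := by
      have := (hη j).ne'
      field_simp
    rw [e2, one_smul]
    abel
  rw [hv.average k hk1 hkn]
  simp_rw [hy, map_add, smul_add]
  -- Only the first operator sees the right-hand side, and its weight η_1 cancels the 1/η_1 in
  -- τ²/η_1.
  rw [Finset.sum_add_distrib, Finset.sum_eq_single (⟨0, hm⟩ : Fin m)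
    (f := fun j => η j • ((G j : H →ₗ[𝕜] H).restrictScalars ℝ)
      ((τ ^ 2 / η j) • if j = ⟨0, hm⟩ then g else 0))]
  · congr 1
    · simp only [LinearMap.sum_apply, LinearMap.smul_apply]
    · rw [if_pos rfl, map_smul, smul_smul]
      congr 1
      have := (hη ⟨0, hm⟩).ne'
      field_simp
  · intro j _ hj
    rw [if_neg hj, smul_zero, map_zero, smul_zero]
  · intro h
    exact absurd (Finset.mem_univ _) h

variable [CompleteSpace H]

/-- Writing x = Gx + cA(Gx) gives (Gx, x) = ‖Gx‖² + c(A Gx, Gx), and symmetry of A gives that of G.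
-/
theorem isFirm_resolvent (hin : ∀ x y : H, inner ℝ x y = RCLike.re (inner 𝕜 x y))
    {A : H →ₗ.[𝕜] H} (hA : IsSelfAdjoint A) (hpos : IsPositiveDefinite A) {c : ℝ} (hc : 0 < c)
    {G : H →L[𝕜] H}
    (hG : ∀ x y, (x ∈ A.domain ∧ x + (c : 𝕜) • opApply A x = y) ↔ G y = x) :
    IsFirm ((G : H →ₗ[𝕜] H).restrictScalars ℝ) where
  symm x y := by
    obtain ⟨hx, ex⟩ := (hG (G x) x).2 rfl
    obtain ⟨hy, ey⟩ := (hG (G y) y).2 rfl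
    show inner ℝ (G x) y = inner ℝ x (G y)
    conv_lhs => rw [← ey]
    conv_rhs => rw [← ex]
    rw [hin, hin, inner_add_left, inner_add_right, inner_smul_left, inner_smul_right,
      RCLike.conj_ofReal, inner_opApply_symm hA hx hy]
  firm x := by
    obtain ⟨hx, ex⟩ := (hG (G x) x).2 rfl
    show ‖G x‖ ^ 2 ≤ inner ℝ (G x) x
    have e : inner ℝ (G x) x = inner ℝ (G x + (c : 𝕜) • opApply A (G x)) (G x) := by
      rw [ex, real_inner_comm]
    rw [e, hin, inner_add_left, inner_smul_left, RCLike.conj_ofReal, map_add,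
      RCLike.re_ofReal_mul, inner_self_eq_norm_sq]
    have := mul_nonneg hc.le (re_inner_opApply_nonneg hpos hx)
    linarith

theorem exists_scheme_error_bound (hin : ∀ x y : H, inner ℝ x y = RCLike.re (inner 𝕜 x y))
    {A : H →ₗ.[𝕜] H} (hA : IsSelfAdjoint A) (hApos : IsPositiveDefinite A)
    {m : ℕ} {Aj : Fin m → H →ₗ.[𝕜] H} (hAj : ∀ j, IsSelfAdjoint (Aj j))
    (hAjpos : ∀ j, IsPositiveDefinite (Aj j)) (hsum : A = ∑ j, Aj j)
    {η : Fin m → ℝ} (hη : ∀ j, 0 < η j) (hηsum : ∑ j, η j = 1)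
    {M : H → H} {a : ℝ} (ha : 0 ≤ a) (hM : ∀ x y : H, ‖M x - M y‖ ≤ a * ‖x - y‖)
    {T : ℝ} (hT : 0 < T) {f : ℝ → H} {φ₀ φ₁ : H} {u : ℝ → H}
    (hu : IsSolution A M T f φ₀ φ₁ u) {lam : ℝ≥0} (hlam1 : lam ≤ 1)
    (hf : ∃ K : ℝ≥0, HolderOnWith K lam f (Set.Icc 0 T))
    (hAu : ∃ K : ℝ≥0, HolderOnWith K lam (fun t => opApply (sqrtOp A) (u t)) (Set.Icc 0 T)) :
    ∃ c : ℝ, 0 < c ∧ ∀ n : ℕ, 1 < n → ∀ (v : ℕ → H) (y : Fin m → ℕ → H),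
      IsSchemeSolution Aj η M f φ₀ φ₁ (T / n) n v y →
      ∀ k : ℕ, k ≤ n → ‖u (k * (T / n)) - v k‖ ≤ c * (T / n) ^ (lam : ℝ) := by
  have hm : 0 < m := by
    rcases Nat.eq_zero_or_pos m with rfl | h
    · simp at hηsum
    · exact h
  obtain ⟨Kf, hf⟩ := hf
  obtain ⟨K, hAu⟩ := hAu
  have hlam1' : (lam : ℝ) ≤ 1 := by exact_mod_cast hlam1
  have hdom : ∀ x, x ∈ A.domain ↔ ∀ j, x ∈ (Aj j).domain := fun x => by
    rw [hsum, mem_domain_sum]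
    simp
  have hop : ∀ x ∈ A.domain, opApply A x = ∑ j, opApply (Aj j) x := fun x hx => by
    have h := opApply_sum Finset.univ Aj (x := x) fun j _ => (hdom x).1 hx j
    rwa [← hsum] at h
  -- Only Au is assumed continuous; the relative bounds make every A_j u bounded on [0, T].
  choose Cj hCj0 hCj using fun j =>
    exists_relative_bound hA hApos (hAj j) fun x hx => (hdom x).1 hx j
  obtain ⟨CA, hCA⟩ := isCompact_Icc.exists_bound_of_continuousOn hu.continuousOn_op
  have hCA0 : 0 ≤ CA := (norm_nonneg _).trans (hCA 0 ⟨le_rfl, hT.le⟩)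
  obtain ⟨Lu, hLu0, hLu⟩ := exists_lipschitz_of_contDiffOn hT hu.contDiffOn
  -- u is Lipschitz, so M(u) is Lipschitz and, on a bounded interval, Hölder of order λ.
  set KF : ℝ := Kf + a * Lu * T ^ (1 - (lam : ℝ)) with hKF
  have hKF0 : 0 ≤ KF := by positivity
  have hF : ∀ t ∈ Set.Icc 0 T, ∀ s ∈ Set.Icc 0 T,
      ‖(f t - M (u t)) - (f s - M (u s))‖ ≤ KF * |t - s| ^ (lam : ℝ) := by
    intro t ht s hs
    have h1 := norm_sub_le_of_holderOnWith hf ht hs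
    have hts : |t - s| ≤ T := by
      rw [abs_le]
      constructor <;> linarith [ht.1, ht.2, hs.1, hs.2]
    have h2 : ‖M (u t) - M (u s)‖ ≤ a * (Lu * (T ^ (1 - (lam : ℝ)) * |t - s| ^ (lam : ℝ))) := by
      refine (hM _ _).trans (mul_le_mul_of_nonneg_left ((hLu t ht s hs).trans ?_) ha)
      exact mul_le_mul_of_nonneg_left (abs_le_mul_rpow hts hlam1') hLu0
    rw [show (f t - M (u t)) - (f s - M (u s)) = (f t - f s) - (M (u t) - M (u s)) by abel]
    refine (norm_sub_le _ _).trans ((add_le_add h1 h2).trans_eq ?_)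
    rw [hKF]
    ring
  obtain ⟨CF, hCF⟩ := exists_bound_of_holder hT lam.2 hKF0 hF
  obtain ⟨C, hC0, hC⟩ := exists_error_bound (E := H) (⟨0, hm⟩ : Fin m) hη hηsum hT hu.contDiffOn
    (F := fun t => f t - M (u t)) (b := fun j t => opApply (Aj j) (u t)) (Ca := (∑ j, Cj j) * CA)
    (K := K)
    (fun t ht => by
      rw [← hop _ (hu.mem_domain t ht), ← hu.equation t ht, add_sub_cancel_right])
    lam.2 hlam1' hKF0 K.2 hF hCF
    (fun t ht j => by
      refine (hCj j _ (hu.mem_domain t ht)).trans ?_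
      exact mul_le_mul (Finset.single_le_sum (fun i _ => hCj0 i) (Finset.mem_univ j)) (hCA t ht)
        (norm_nonneg _) (Finset.sum_nonneg fun i _ => hCj0 i))
    (fun t ht s hs => by
      have h1 := hu.mem_domain t ht
      have h2 := hu.mem_domain s hs
      have hle := (isPosSqrt_sqrtOp hA hApos).domain_le
      rw [Finset.sum_sub_distrib, ← hop _ h1, ← hop _ h2, ← opApply_sub h1 h2, hin,
        re_inner_opApply_eq_sqrtOp hA hApos (A.domain.sub_mem h1 h2),
        opApply_sub (hle h1) (hle h2)]
      exact pow_le_pow_left₀ (norm_nonneg _) (norm_sub_le_of_holderOnWith hAu ht hs) 2)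
    ha
  refine ⟨C, hC0, fun n hn v y hv => ?_⟩
  have hτ : 0 < T / n := div_pos hT (by exact_mod_cast (by omega : 0 < n))
  have hc : ∀ j, 0 < (T / n) ^ 2 / η j := fun j => div_pos (pow_pos hτ 2) (hη j)
  choose G hG using fun j => exists_resolvent (hAj j) (hAjpos j) (hc j)
  refine hC n hn (fun j => (G j : H →ₗ[𝕜] H).restrictScalars ℝ) v
    (fun k => f (k * (T / n)) - M (v k))
    (fun j => isFirm_resolvent hin (hAj j) (hAjpos j) (hc j) (hG j)) ?_
    (hv.initial_zero.trans hu.initial_value.symm)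
    (by rw [hv.initial_one, hu.initial_value, hu.initial_velocity])
    (fun k hk1 hkn => hv.eq_resolvent hm hη hτ hG hk1 hkn) ?_
  · intro j t ht
    have h1 := (hG j (u t) _).1 ⟨(hdom _).1 (hu.mem_domain t ht) j, rfl⟩
    rw [← RCLike.real_smul_eq_coe_smul (K := 𝕜)] at h1
    have h2 : ((G j : H →ₗ[𝕜] H).restrictScalars ℝ)
        (u t + ((T / n) ^ 2 / η j) • opApply (Aj j) (u t)) = u t := h1
    rw [map_add, map_smul] at h2
    exact eq_sub_of_add_eq' h2
  · intro k _
    rw [sub_sub_sub_cancel_left, norm_sub_rev]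
    exact hM _ _

end Real

end AbstractHyperbolic

theorem mainTheorem3 {𝕜 H : Type*} [RCLike 𝕜] [NormedAddCommGroup H] [InnerProductSpace 𝕜 H]
    [CompleteSpace H] [NormedSpace ℝ H] [IsScalarTower ℝ 𝕜 H]
    (A : H →ₗ.[𝕜] H) (hA : IsSelfAdjoint A) (hApos : AbstractHyperbolic.IsPositiveDefinite A)
    (m : ℕ) (Aj : Fin m → H →ₗ.[𝕜] H) (hAj : ∀ j, IsSelfAdjoint (Aj j))
    (hAjpos : ∀ j, AbstractHyperbolic.IsPositiveDefinite (Aj j)) (hsum : A = ∑ j, Aj j)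
    (η : Fin m → ℝ) (hη : ∀ j, 0 < η j ∧ η j < 1) (hηsum : ∑ j, η j = 1)
    (M : H → H) (a : ℝ) (ha : 0 < a) (hM : ∀ x y : H, ‖M x - M y‖ ≤ a * ‖x - y‖)
    (T : ℝ) (hT : 0 < T) (f : ℝ → H) (φ₀ φ₁ : H) (u : ℝ → H)
    (hu : AbstractHyperbolic.IsSolution A M T f φ₀ φ₁ u)
    (lam : ℝ≥0) (hlam0 : 0 < lam) (hlam1 : lam ≤ 1)
    (hf : ∃ K : ℝ≥0, HolderOnWith K lam f (Set.Icc 0 T))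
    (hAu : ∃ K : ℝ≥0, HolderOnWith K lam
      (fun t => AbstractHyperbolic.opApply (AbstractHyperbolic.sqrtOp A) (u t)) (Set.Icc 0 T)) :
    ∃ c : ℝ, 0 < c ∧ ∀ n : ℕ, 1 < n → ∀ (v : ℕ → H) (y : Fin m → ℕ → H),
      AbstractHyperbolic.IsSchemeSolution Aj η M f φ₀ φ₁ (T / n) n v y →
      ∀ k : ℕ, k ≤ n → ‖u (k * (T / n)) - v k‖ ≤ c * (T / n) ^ (lam : ℝ) := by
  -- The scalar tower forces the real structure to be the restricted one, so the real inner product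
  -- Re(x, y) can be installed on it.
  have hinst : ‹NormedSpace ℝ H› = NormedSpace.restrictScalars ℝ 𝕜 H := by
    ext r x
    exact RCLike.real_smul_eq_coe_smul (K := 𝕜) r x
  subst hinst
  let : InnerProductSpace ℝ H := InnerProductSpace.rclikeToReal 𝕜 H
  exact AbstractHyperbolic.exists_scheme_error_bound (fun _ _ => rfl) hA hApos hAj hAjpos hsum
    (fun j => (hη j).1) hηsum ha.le hM hT hu hlam1 hf hAu
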